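/- **Setting.** Let $S$ be a complete separable metric space and let $M_1=M_1(S)$ be the space of Borel probability measures on $S$ with the topology of weak convergence (equivalently, the Prohorov metric). For a nonzero finite measure $\alpha$ on a Polish space $X$, $\mathcal D(\alpha)$ denotes the law of a Dirichlet process with parameter $\alpha$: the law of a random probability measure $\lambda$ on $X$ with $(\lambda(B_0),\dots,\lambda(B_d))\sim\mathrm{Dir}(\alpha(B_0),\dots,\alpha(B_d))$ for every finite measurable partition $\{B_0,\dots,B_d\}$ of $X$. (In $\mathrm{Dir}$ a zero parameter gives a coordinate equal to $0$.) Let $\kappa,\varepsilon>0$ and $\varrho\in M_1$. Let $\xi=\{\xi_{ij}\}_{i,j\ge1}$ be an array of $S$-valued random variables sampled from a nested Dirichlet process: there are a random probability measure $\varpi$ on $M_1$ with $\varpi\sim\mathcal D(\kappa\,\mathcal D(\varepsilon\varrho))$ and random elements $\mu_1,\mu_2,\dots$ of $M_1$ that are i.i.d. with law $\varpi$ given $\varpi$, such that, given $\varpi$ and $(\mu_i)_i$, the $\xi_{ij}$ are independent with $\xi_{ij}\sim\mu_i$. Fix $M,N\in\mathbb N$, a countable set $T$ and maps $\varphi_m:S^N\to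 T$ $(1\le m\le M)$ such that $\varphi_m^{-1}(\{t\})$ is Borel for every $t\in T$. Let $Y_m=\varphi_m(\xi_{m1},\dots,\xi_{mN})$ and $Y=(Y_1,\dots,Y_M)$. Fix $y=(y_1,\dots,y_M)\in T^M$ with $P(Y=y)>0$, and put $A_m=\varphi_m^{-1}(\{y_m\})\subseteq S^N$. Let $\varrho_N(A)=\int_{M_1}\nu^N(A)\,\mathcal D(\varepsilon\varrho,d\nu)$, which is the law of $(\xi_{m1},\dots,\xi_{mN})$, and let $\varrho_N(\cdot\mid A_m)$ be this law conditioned on $A_m$. A *weighted simulation* consists of $M_1$-valued random variables $u_1^*,\dots,u_M^*$ and weights $t_{mi}$, $1\le i\le m\le M$, where $t_{mi}=(u_i^*)^N(A_m)$ for $i<m$ and $t_{mm}=\kappa\varrho_N(A_m)$, such that for each $m$ the conditional law of $u_m^*$ given $(u_1^*,\dots,u_{m-1}^*)$ is $$\frac{1}{t_{m1}+\cdots+t_{mm}}\Big(t_{mm}\int_{S^N}\mathcal D\Big(\varepsilon\varrho+\sum_{n=1}^N\delta_{x_n}\Big)\,\varrho_N(dx\mid A_m)+\sum_{i=1}^{m-1}t_{mi}\,\delta_{u_i^*}\Big).$$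 Its total weight is $V=\prod_{m=1}^M\frac1{\kappa+m-1}\sum_{i=1}^m t_{mi}$. Let $(u_1^{*,k},\dots,u_M^{*,k})$, $k=1,2,\dots$, be independent weighted simulations, with total weights $V_k$. **Claim.** Almost surely with respect to the simulations, in the sense of weak convergence of probability measures on $M_1$, $$\mathcal L(\mu_{M+1}\mid Y=y)=\lim_{K\to\infty}\frac1{\kappa+M}\Big(\kappa\,\mathcal D(\varepsilon\varrho)+\sum_{m=1}^M\frac{\sum_{k=1}^K V_k\,\delta(u_m^{*,k})}{\sum_{k=1}^K V_k}\Big).$$ Consequently, if $\Phi$ is a measurable function from $M_1$ to a metric space and $P(\mu_{M+1}\in D^c\mid Y=y)=1$, where $D\subseteq M_1$ is the set of discontinuities of $\Phi$, then, almost surely and in the sense of weak convergence, $$\mathcal L(\Phi(\mu_{M+1})\mid Y=y)=\lim_{K\to\infty}\frac1{\kappa+M}\Big(\kappa\,\mathcal D(\varepsilon\varrho)\circ\Phi^{-1}+\sum_{m=1}^M\frac{\sum_{k=1}^K V_k\,\delta(\Phi(u_m^{*,k}))}{\sum_{k=1}^K V_k}\Big).$$ -/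

import Mathlib

open MeasureTheory ProbabilityTheory Filter Topology Set
open scoped NNReal ENNReal BoundedContinuousFunction

noncomputable section

namespace NDP

/-! ### Dirichlet distributions and Dirichlet processes -/

/-- The Gamma distribution with shape `a ≥ 0` and rate `1`; shape `0` is the point mass at `0`. -/
def gammaLaw (a : ℝ) : Measure ℝ := if a = 0 then Measure.dirac 0 else gammaMeasure a 1

/-- The Dirichlet distribution with parameters `a i ≥ 0`, not all zero: the law of
`(g i / ∑ j, g j)ᵢ` for independent `g i` with `g i ∼ Gamma(a i, 1)`. -/
def dirichletDistribution {ι : Type*} [Fintype ι] (a : ι → ℝ) : Measure (ι → ℝ) :=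
  (Measure.pi fun i => gammaLaw (a i)).map fun g i => g i / ∑ j, g j

/-- `D` is the law of a Dirichlet process with parameter `α`: for `lam ∼ D` and every finite
measurable partition `B₀, …, B_d`, the vector `(lam(B₀), …, lam(B_d))` has the
`Dir(α(B₀), …, α(B_d))` distribution. -/
def IsDirichletLaw {S : Type*} [MeasurableSpace S] (α : Measure S)
    (D : Measure (ProbabilityMeasure S)) : Prop :=
  ∀ (d : ℕ) (B : Fin (d + 1) → Set S), (∀ i, MeasurableSet (B i)) →
    Pairwise (fun i j => Disjoint (B i) (B j)) → (⋃ i, B i) = univ →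
    D.map (fun (lam : ProbabilityMeasure S) i => (lam : Measure S).real (B i)) =
      dirichletDistribution fun i => α.real (B i)

open Classical in
/-- `𝒟(α)`, the law of a Dirichlet process with parameter `α`. The finite-dimensional
distributions determine it, since they determine all joint laws of `lam(B₁), …, lam(Bₙ)`; on a
Polish space it exists for every nonzero finite `α`. -/
def dirichletLaw {S : Type*} [MeasurableSpace S] (α : Measure S) :
    Measure (ProbabilityMeasure S) :=
  if h : ∃ D : Measure (ProbabilityMeasure S), IsDirichletLaw α D then h.choose else 0

theorem isProbabilityMeasure_gammaLaw {a : ℝ} (ha : 0 ≤ a) :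
    IsProbabilityMeasure (gammaLaw a) := by
  unfold gammaLaw
  split_ifs with h
  · infer_instance
  · exact isProbabilityMeasure_gammaMeasure (lt_of_le_of_ne ha (Ne.symm h)) one_pos

theorem isProbabilityMeasure_dirichletDistribution {ι : Type*} [Fintype ι] {a : ι → ℝ}
    (ha : ∀ i, 0 ≤ a i) : IsProbabilityMeasure (dirichletDistribution a) := by
  have := fun i => isProbabilityMeasure_gammaLaw (ha i)
  unfold dirichletDistribution
  exact Measure.isProbabilityMeasure_map (by fun_prop)

theorem IsDirichletLaw.isProbabilityMeasure {S : Type*} [MeasurableSpace S] {α : Measure S}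
    {D : Measure (ProbabilityMeasure S)} (h : IsDirichletLaw α D) : IsProbabilityMeasure D := by
  have h0 := h 0 (fun _ => univ) (fun _ => MeasurableSet.univ)
    (fun i j hij => absurd (Subsingleton.elim (α := Fin 1) i j) hij) (iUnion_const _)
  have := isProbabilityMeasure_dirichletDistribution
    (a := fun _ : Fin (0 + 1) => α.real univ) (fun _ => measureReal_nonneg)
  have h1 := congrArg (fun m => m univ) h0
  simp only [measure_univ] at h1
  rw [Measure.map_apply (by simp) MeasurableSet.univ, preimage_univ] at h1
  exact ⟨h1⟩

theorem dirichletLaw_univ_le {S : Type*} [MeasurableSpace S] (α : Measure S) :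
    dirichletLaw α univ ≤ 1 := by
  unfold dirichletLaw
  split_ifs with h
  · have := h.choose_spec.isProbabilityMeasure
    exact prob_le_one
  · simp

/-! ### Product kernels and the nested Dirichlet process -/

/-- `(ν i)ᵢ ↦ ⨂ᵢ ν i`, as a probability kernel. -/
def productKernel (ι S : Type*) [MeasurableSpace S] :
    Kernel (ι → ProbabilityMeasure S) (ι → S) where
  toFun ν := Measure.infinitePi fun i => (ν i : Measure S)
  measurable' := by
    refine Measurable.measure_of_isPiSystem_of_isProbabilityMeasure
      (S := squareCylinders fun _ : ι => {s : Set S | MeasurableSet s}) ?_ ?_ ?_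
    · exact (generateFrom_squareCylinders).symm
    · exact isPiSystem_squareCylinders (fun _ => MeasurableSpace.isPiSystem_measurableSet)
        (fun _ => MeasurableSet.univ)
    · rintro _ ⟨s, t, ht, rfl⟩
      have ht' : ∀ i, MeasurableSet (t i) := fun i => ht i (mem_univ i)
      simp_rw [Measure.infinitePi_pi _ (s := s) (t := t) (fun i _ => ht' i)]
      refine Finset.measurable_prod _ fun i _ => ?_
      exact (Measure.measurable_coe (ht' i)).comp
        (measurable_subtype_coe.comp (measurable_pi_apply i))

instance (ι S : Type*) [MeasurableSpace S] : IsMarkovKernel (productKernel ι S) :=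
  ⟨fun ν => inferInstanceAs
    (IsProbabilityMeasure (Measure.infinitePi fun i => (ν i : Measure S)))⟩

/-- `ξ` is an array of samples from a nested Dirichlet process on `S` with column concentration
`κ`, row concentration `ε` and base measure `ϱ`; its row distribution generator is `ϖ` and its
row distributions are `μ 0, μ 1, …`. That is, `ϖ ∼ 𝒟(κ 𝒟(ε ϱ))`; given `ϖ`, the `μ i` are
i.i.d. with law `ϖ`; given `ϖ` and `μ`, the `ξ i j` are independent and `ξ i j ∼ μ i`. -/
structure IsNestedDirichletArray {S Ω : Type*} [MeasurableSpace S] [MeasurableSpace Ω]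
    (P : Measure Ω) (κ ε : ℝ≥0) (ϱ : ProbabilityMeasure S)
    (ϖ : Ω → ProbabilityMeasure (ProbabilityMeasure S))
    (μ : ℕ → Ω → ProbabilityMeasure S) (ξ : ℕ → ℕ → Ω → S) : Prop where
  measurable_generator : Measurable ϖ
  measurable_row : ∀ i, Measurable (μ i)
  measurable_entry : ∀ i j, Measurable (ξ i j)
  law_generator : HasLaw ϖ
    (dirichletLaw ((κ : ℝ≥0∞) • dirichletLaw ((ε : ℝ≥0∞) • (ϱ : Measure S)))) P
  law_rows : HasCondDistrib (fun ω i => μ i ω) ϖ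
    ((productKernel ℕ (ProbabilityMeasure S)).comap (fun ν _ => ν) (by fun_prop)) P
  law_entries : HasCondDistrib (fun ω (p : ℕ × ℕ) => ξ p.1 p.2 ω)
    (fun ω => (ϖ ω, fun i => μ i ω))
    ((productKernel (ℕ × ℕ) S).comap
      (fun (q : ProbabilityMeasure (ProbabilityMeasure S) × (ℕ → ProbabilityMeasure S))
        (p : ℕ × ℕ) => q.2 p.1) (by fun_prop)) P

/-! ### Weighted simulations -/

section Simulation

variable {S : Type*} [MeasurableSpace S]

/-- `ν^N`, the `N`-fold product measure. -/
def iidLaw (N : ℕ) (ν : ProbabilityMeasure S) : Measure (Fin N → S) :=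
  Measure.pi fun _ => (ν : Measure S)

/-- `ϱ_N`, the law of the first `N` entries of a row: `∫ ν^N 𝒟(ε ϱ)(dν)`. -/
def sampleLaw (ε : ℝ≥0) (ϱ : ProbabilityMeasure S) (N : ℕ) : Measure (Fin N → S) :=
  (dirichletLaw ((ε : ℝ≥0∞) • (ϱ : Measure S))).bind (iidLaw N)

/-- `∫ 𝒟(ε ϱ + ∑ₙ δ_{x n}) ϱ_N(dx | A)`, the law of a row distribution given only that the
first `N` entries of that row lie in `A`. -/
def rowPosterior (ε : ℝ≥0) (ϱ : ProbabilityMeasure S) {N : ℕ} (A : Set (Fin N → S)) :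
    Measure (ProbabilityMeasure S) :=
  (cond (sampleLaw ε ϱ N) A).bind fun x =>
    dirichletLaw ((ε : ℝ≥0∞) • (ϱ : Measure S) + ∑ n, Measure.dirac (x n))

/-- `t_{mm} = κ ϱ_N(A_m)`. -/
def newWeight (κ ε : ℝ≥0) (ϱ : ProbabilityMeasure S) {N : ℕ} (A : Set (Fin N → S)) : ℝ≥0∞ :=
  κ * sampleLaw ε ϱ N A

/-- `t_{mi} = (u_i)^N(A_m)` for `i < m`. -/
def oldWeight {N : ℕ} (A : Set (Fin N → S)) (ν : ProbabilityMeasure S) : ℝ≥0∞ :=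
  iidLaw N ν A

/-- `t_{m1} + ⋯ + t_{mm}`, where `ν` lists the earlier simulated rows `u_i`, `i < m`. -/
def rowWeightSum (κ ε : ℝ≥0) (ϱ : ProbabilityMeasure S) {N : ℕ} (A : Set (Fin N → S))
    {ι : Type*} [Fintype ι] (ν : ι → ProbabilityMeasure S) : ℝ≥0∞ :=
  newWeight κ ε ϱ A + ∑ i, oldWeight A (ν i)

theorem measurable_oldWeight {N : ℕ} {A : Set (Fin N → S)} (hA : MeasurableSet A) :
    Measurable (oldWeight (S := S) A) := by
  have h : Measurable (iidLaw (S := S) N) := by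
    have : ∀ ν : ProbabilityMeasure S, IsProbabilityMeasure (iidLaw N ν) := fun ν => by
      unfold iidLaw; infer_instance
    refine Measurable.measure_of_isPiSystem_of_isProbabilityMeasure
      generateFrom_pi.symm isPiSystem_pi ?_
    rintro _ ⟨t, ht, rfl⟩
    simp only [iidLaw, Measure.pi_pi]
    refine Finset.measurable_prod _ fun i _ => ?_
    exact (Measure.measurable_coe (ht i (mem_univ i))).comp measurable_subtype_coe
  exact (Measure.measurable_coe hA).comp h

/-- The conditional law of the next simulated row distribution given the earlier ones `ν`: the
probability measure proportional to
`t_{mm} ∫ 𝒟(ε ϱ + ∑ₙ δ_{x n}) ϱ_N(dx | A) + ∑_{i < m} t_{mi} δ_{ν i}`. -/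
def simulationKernel (κ ε : ℝ≥0) (ϱ : ProbabilityMeasure S) {N : ℕ} (A : Set (Fin N → S))
    (hA : MeasurableSet A) (ι : Type*) [Fintype ι] :
    Kernel (ι → ProbabilityMeasure S) (ProbabilityMeasure S) where
  toFun ν := (rowWeightSum κ ε ϱ A ν)⁻¹ •
    (newWeight κ ε ϱ A • rowPosterior ε ϱ A + ∑ i, oldWeight A (ν i) • Measure.dirac (ν i))
  measurable' := by
    have h := measurable_oldWeight hA
    refine Measure.measurable_of_measurable_coe _ fun B hB => ?_
    simp only [rowWeightSum, Measure.smul_apply, Measure.add_apply, Measure.finsetSum_apply,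
      smul_eq_mul, Measure.dirac_apply' _ hB]
    have h1 : Measurable (B.indicator (1 : ProbabilityMeasure S → ℝ≥0∞)) :=
      measurable_one.indicator hB
    fun_prop

theorem rowPosterior_univ_le (ε : ℝ≥0) (ϱ : ProbabilityMeasure S) {N : ℕ}
    (A : Set (Fin N → S)) : rowPosterior ε ϱ A univ ≤ 1 := by
  unfold rowPosterior
  by_cases h : AEMeasurable (fun x : Fin N → S =>
      dirichletLaw ((ε : ℝ≥0∞) • (ϱ : Measure S) + ∑ n, Measure.dirac (x n)))
      (cond (sampleLaw ε ϱ N) A)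
  · rw [Measure.bind_apply MeasurableSet.univ h]
    refine (lintegral_mono fun x => dirichletLaw_univ_le _).trans ?_
    simpa using prob_le_one
  · rw [Measure.bind, Measure.map_of_not_aemeasurable h]
    simp

instance (κ ε : ℝ≥0) (ϱ : ProbabilityMeasure S) {N : ℕ} (A : Set (Fin N → S))
    (hA : MeasurableSet A) (ι : Type*) [Fintype ι] :
    IsFiniteKernel (simulationKernel κ ε ϱ A hA ι) := by
  refine ⟨⟨1, ENNReal.one_lt_top, fun ν => ?_⟩⟩
  change ((rowWeightSum κ ε ϱ A ν)⁻¹ • (newWeight κ ε ϱ A • rowPosterior ε ϱ A +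
    ∑ i, oldWeight A (ν i) • Measure.dirac (ν i))) univ ≤ 1
  simp only [Measure.smul_apply, Measure.add_apply, Measure.finsetSum_apply, smul_eq_mul,
    measure_univ, mul_one]
  refine le_trans ?_ (ENNReal.inv_mul_le_one (rowWeightSum κ ε ϱ A ν))
  unfold rowWeightSum
  gcongr
  exact mul_le_of_le_one_right' (rowPosterior_univ_le ε ϱ A)

/-- `u = (u_m)_{m < M}` are the simulated row distributions of a weighted simulation for the
observation sets `A_m`: given `(u_i)_{i < m}`, the next one, `u_m`, is drawn from
`simulationKernel`. -/
structure IsWeightedSimulation {Ω : Type*} [MeasurableSpace Ω] (P : Measure Ω) (κ ε : ℝ≥0)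
    (ϱ : ProbabilityMeasure S) {M N : ℕ} (A : Fin M → Set (Fin N → S))
    (hA : ∀ m, MeasurableSet (A m)) (u : Fin M → Ω → ProbabilityMeasure S) : Prop where
  measurable : ∀ m, Measurable (u m)
  law : ∀ m, HasCondDistrib (u m) (fun ω (i : Iio m) => u i ω)
    (simulationKernel κ ε ϱ (A m) (hA m) (Iio m)) P

/-- The total weight `V = ∏_m (κ + m - 1)⁻¹ ∑_{i ≤ m} t_{mi}` (rows are numbered from `0` here,
so that `κ + m - 1` becomes `κ + m`). -/
def totalWeight (κ ε : ℝ≥0) (ϱ : ProbabilityMeasure S) {M N : ℕ} (A : Fin M → Set (Fin N → S))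
    (u : Fin M → ProbabilityMeasure S) : ℝ≥0∞ :=
  ∏ m : Fin M, ((κ : ℝ≥0∞) + (m : ℕ))⁻¹ * rowWeightSum κ ε ϱ (A m) (fun i : Iio m => u i)

end Simulation

/-! ### Weak convergence and the approximating measures -/

/-- Weak convergence of the measures `Q K` to `Q'` as `K → ∞`. -/
def WeaklyConverges {E : Type*} [TopologicalSpace E] [MeasurableSpace E]
    (Q : ℕ → Measure E) (Q' : Measure E) : Prop :=
  ∀ f : E →ᵇ ℝ, Tendsto (fun K => ∫ x, f x ∂(Q K)) atTop (𝓝 (∫ x, f x ∂Q'))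

/-- The weighted empirical law `∑_{k < K} V k δ_{x k} / ∑_{k < K} V k`. -/
def weightedEmpirical {E : Type*} [MeasurableSpace E] (V : ℕ → ℝ≥0∞) (x : ℕ → E) (K : ℕ) :
    Measure E :=
  (∑ k ∈ Finset.range K, V k)⁻¹ • ∑ k ∈ Finset.range K, V k • Measure.dirac (x k)

/-- `(κ + M)⁻¹ (κ D + ∑_{m < M} ∑_{k < K} V k δ_{x k m} / ∑_{k < K} V k)`. -/
def newRowApprox {E : Type*} [MeasurableSpace E] (κ : ℝ≥0) {M : ℕ} (D : Measure E)
    (V : ℕ → ℝ≥0∞) (x : ℕ → Fin M → E) (K : ℕ) : Measure E :=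
  ((κ : ℝ≥0∞) + M)⁻¹ •
    ((κ : ℝ≥0∞) • D + ∑ m : Fin M, weightedEmpirical V (fun k => x k m) K)

end NDP

end

noncomputable section

namespace NDP

/-! ### Gamma distributions -/

/-! The claim is importance sampling for a Pólya urn. With `ϖ` integrated out, the rows form an urn
with base measure `κ 𝒟(ε ϱ)`: after `m` rows the next one has law `(κ + m)⁻¹ (κ 𝒟(ε ϱ) + ∑ δ_{μ
i})`. Given the rows, the observations have likelihood `∏ (μ m)^N(A m)`, so the unnormalised
posterior of the first `M` rows is the urn law with this density, called `rowLikelihood`. One more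
urn step expresses the posterior of the next row through it (`measure_next_row_observations`).

By Bayes' formula for one Dirichlet process, `ϱ_N(A)` times the row posterior given `A` is `𝒟(ε ϱ)`
with density `ν^N(A)`. Hence a simulation step multiplied by its normaliser `t_{m1} + ⋯ + t_{mm}` is
the unnormalised urn step with density `ν^N(A m)`. These normalisers, divided by those of the urn,
are the factors of `V`. Induction over the rows gives `E[V F(u)] = ∫ F d(rowLikelihood)`
(`lintegral_partialWeight`). The strong law for the bounded variables `V` and `V 1_B(u m)` then
yields convergence of the weighted empirical laws on each measurable `B`, almost surely.

To exchange "almost surely" with "for all test sets", convergence is required only on the countably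
many finite unions of basic open sets of the weak topology. These approximate every open set from
inside, so the portmanteau theorem gives weak convergence and also the version with `Φ`.

All facts on Dirichlet processes are derived from the finite-dimensional laws: proportions of
independent Gamma variables are independent of their sum, which gives size biasing (hence Bayes'
formula) and stick breaking. Stick breaking builds `𝒟(α + δ_x)` from `𝒟(α)`, so posteriors exist as
soon as the prior does, and the priors exist because the given array is sampled from them. -/

theorem ext_of_lintegral_exp {m₁ m₂ : Measure ℝ} [IsFiniteMeasure m₁] [IsFiniteMeasure m₂]
    (hfin : ∀ s < 1, ∫⁻ x, ENNReal.ofReal (Real.exp (s * x)) ∂m₁ ≠ ∞)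
    (h : ∀ s < 1, ∫⁻ x, ENNReal.ofReal (Real.exp (s * x)) ∂m₁ =
      ∫⁻ x, ENNReal.ofReal (Real.exp (s * x)) ∂m₂) : m₁ = m₂ := by
  have hint : ∀ (m : Measure ℝ), (∀ s < 1, ∫⁻ x, ENNReal.ofReal (Real.exp (s * x)) ∂m ≠ ∞) →
      Iio 1 ⊆ interior (integrableExpSet id m) := by
    intro m hm
    refine interior_maximal (fun s hs => ?_) isOpen_Iio
    refine ⟨by fun_prop, ?_⟩
    rw [hasFiniteIntegral_iff_ofReal (ae_of_all _ fun x => (Real.exp_pos _).le)]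
    exact (hm s hs).lt_top
  have h1 := hint m₁ hfin
  have h2 := hint m₂ fun s hs => h s hs ▸ hfin s hs
  have hmgf : ∀ s < 1, complexMGF id m₁ (s : ℝ) = complexMGF id m₂ (s : ℝ) := by
    intro s hs
    rw [complexMGF_ofReal, complexMGF_ofReal]
    congr 1
    simp only [mgf, id]
    rw [integral_eq_lintegral_of_nonneg_ae (ae_of_all _ fun x => (Real.exp_pos _).le) (by fun_prop),
      integral_eq_lintegral_of_nonneg_ae (ae_of_all _ fun x => (Real.exp_pos _).le) (by fun_prop),
      h s hs]
  have hopen : IsPreconnected {z : ℂ | z.re ∈ Iio (1 : ℝ)} :=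
    (convex_Iio (1 : ℝ)).linear_preimage Complex.reLm |>.isPreconnected
  -- Both complex transforms are analytic on `Re z < 1` and agree at real points near `0`. They
  -- therefore agree on the imaginary axis, where they are the characteristic functions.
  have key := AnalyticOnNhd.eqOn_of_preconnected_of_frequently_eq
    (f := complexMGF id m₁) (g := complexMGF id m₂) (z₀ := ((0 : ℝ) : ℂ))
    (analyticOnNhd_complexMGF.mono fun z hz => h1 hz)
    (analyticOnNhd_complexMGF.mono fun z hz => h2 hz) hopen (show ((0 : ℝ) : ℂ).re < 1 by simp) ?_
  · refine Measure.ext_of_charFun ?_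
    ext t
    rw [← complexMGF_id_mul_I, ← complexMGF_id_mul_I]
    exact key (show ((t : ℂ) * Complex.I).re < 1 by simp)
  · have hlim : Tendsto (fun s : ℝ => (s : ℂ)) (𝓝[≠] 0) (𝓝[≠] ((0 : ℝ) : ℂ)) := by
      refine tendsto_nhdsWithin_iff.2 ⟨?_, ?_⟩
      · exact (Complex.continuous_ofReal.tendsto 0).mono_left nhdsWithin_le_nhds
      · filter_upwards [self_mem_nhdsWithin] with s hs
        simpa using hs
    refine hlim.frequently (Eventually.frequently ?_)
    filter_upwards [nhdsWithin_le_nhds (Iio_mem_nhds (zero_lt_one' ℝ))] with s hs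
    exact hmgf s hs

/-! ### Finite product measures and product densities. -/

theorem ext_of_univ_pi {ι : Type*} [Finite ι] {X : ι → Type*} [∀ i, MeasurableSpace (X i)]
    {m₁ m₂ : Measure (∀ i, X i)} [IsFiniteMeasure m₁]
    (h : ∀ s : ∀ i, Set (X i), (∀ i, MeasurableSet (s i)) →
      m₁ (univ.pi s) = m₂ (univ.pi s)) : m₁ = m₂ := by
  refine ext_of_generate_finite _ generateFrom_pi.symm isPiSystem_pi ?_ ?_
  · rintro _ ⟨s, hs, rfl⟩
    exact h s fun i => hs i (mem_univ i)
  · simpa using h (fun _ => univ) fun _ => MeasurableSet.univ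

theorem lintegral_pi_prod {ι : Type*} [Fintype ι] {X : ι → Type*} [∀ i, MeasurableSpace (X i)]
    (m : ∀ i, Measure (X i)) [∀ i, IsProbabilityMeasure (m i)] {f : ∀ i, X i → ℝ≥0∞}
    (hf : ∀ i, Measurable (f i)) :
    ∫⁻ x, ∏ i, f i (x i) ∂(Measure.pi m) = ∏ i, ∫⁻ x, f i x ∂(m i) := by
  have h := lintegral_prod_eq_prod_lintegral_of_indepFun (μ := Measure.pi m) Finset.univ
    (fun i (x : ∀ i, X i) => f i (x i)) (iIndepFun_pi fun i => (hf i).aemeasurable)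
    (fun i => (hf i).comp (measurable_pi_apply i))
  rw [h]
  refine Finset.prod_congr rfl fun i _ => ?_
  exact (measurePreserving_eval m i).lintegral_comp (hf i)

theorem withDensity_pi_univ_pi {ι : Type*} [Fintype ι] {X : ι → Type*}
    [∀ i, MeasurableSpace (X i)]
    (m : ∀ i, Measure (X i)) [∀ i, IsProbabilityMeasure (m i)] {f : ∀ i, X i → ℝ≥0∞}
    (hf : ∀ i, Measurable (f i)) {s : ∀ i, Set (X i)} (hs : ∀ i, MeasurableSet (s i)) :
    ((Measure.pi m).withDensity fun x => ∏ i, f i (x i)) (univ.pi s) =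
      ∏ i, (m i).withDensity (f i) (s i) := by
  rw [withDensity_apply _ (MeasurableSet.univ_pi hs), ← lintegral_indicator (.univ_pi hs)]
  have : ∀ x : ∀ i, X i, (univ.pi s).indicator (fun x => ∏ i, f i (x i)) x =
      ∏ i, (s i).indicator (f i) (x i) := by
    intro x
    by_cases hx : x ∈ univ.pi s
    · rw [indicator_of_mem hx]
      exact Finset.prod_congr rfl fun i _ => (indicator_of_mem (hx i (mem_univ i)) _).symm
    · rw [indicator_of_notMem hx]
      obtain ⟨i, hi⟩ : ∃ i, x i ∉ s i := by simpa [Set.mem_pi] using hx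
      exact (Finset.prod_eq_zero (Finset.mem_univ i) (indicator_of_notMem hi _)).symm
  simp_rw [this]
  rw [lintegral_pi_prod m fun i => (hf i).indicator (hs i)]
  exact Finset.prod_congr rfl fun i _ => by
    rw [withDensity_apply _ (hs i), lintegral_indicator (hs i)]

/-! ### One-dimensional Gamma laws: size biasing and exponential tilting. -/

theorem gammaLaw_zero : gammaLaw 0 = Measure.dirac 0 := by simp [gammaLaw]

theorem gammaLaw_of_pos {a : ℝ} (ha : 0 < a) : gammaLaw a = gammaMeasure a 1 := by
  simp [gammaLaw, ha.ne']

theorem measurable_gammaPDF (a r : ℝ) : Measurable (gammaPDF a r) :=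
  (measurable_gammaPDFReal a r).ennreal_ofReal

theorem lintegral_gammaMeasure (a r : ℝ) {f : ℝ → ℝ≥0∞} (hf : Measurable f) :
    ∫⁻ x, f x ∂(gammaMeasure a r) = ∫⁻ x, gammaPDF a r x * f x := by
  rw [gammaMeasure, lintegral_withDensity_eq_lintegral_mul _ (measurable_gammaPDF a r) hf]
  rfl

theorem gammaLaw_nonneg (a : ℝ) : ∀ᵐ x ∂(gammaLaw a), 0 ≤ x := by
  unfold gammaLaw
  split_ifs with h
  · simp [ae_dirac_eq]
  · rw [gammaMeasure, ae_withDensity_iff (measurable_gammaPDF a 1)]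
    refine ae_of_all _ fun x hx => ?_
    by_contra hlt
    exact hx (gammaPDF_of_neg (not_le.1 hlt))

theorem gammaLaw_pos {a : ℝ} (ha : 0 < a) : ∀ᵐ x ∂(gammaLaw a), 0 < x := by
  have h0 : ∀ᵐ x ∂(gammaLaw a), x ≠ 0 := by
    rw [gammaLaw_of_pos ha, gammaMeasure]
    exact (withDensity_absolutelyContinuous _ _).ae_le (Measure.ae_ne volume 0)
  filter_upwards [h0, gammaLaw_nonneg a] with x h1 h2
  exact lt_of_le_of_ne h2 (Ne.symm h1)

/-- The factor `x` raises the exponent of the density by one, and `Γ(a + 1) = a Γ(a)` accounts for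
the constant. For `a = 0` both sides vanish. -/
theorem gammaLaw_withDensity_id {a : ℝ} (ha : 0 ≤ a) :
    (gammaLaw a).withDensity ENNReal.ofReal = ENNReal.ofReal a • gammaLaw (a + 1) := by
  rcases ha.eq_or_lt with rfl | ha
  · classical
    rw [gammaLaw_zero]
    ext s hs
    rw [withDensity_apply _ hs, setLIntegral_dirac' ENNReal.measurable_ofReal hs]
    simp
  · refine Measure.ext_of_lintegral _ fun f hf => ?_
    rw [lintegral_withDensity_eq_lintegral_mul _ ENNReal.measurable_ofReal hf, lintegral_smul_measure,
      gammaLaw_of_pos ha, gammaLaw_of_pos (by linarith),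
      lintegral_gammaMeasure _ _ (ENNReal.measurable_ofReal.mul hf), lintegral_gammaMeasure _ _ hf,
      smul_eq_mul, ← lintegral_const_mul (f := fun x => gammaPDF (a + 1) 1 x * f x) _
        ((measurable_gammaPDF _ _).mul hf)]
    refine lintegral_congr fun x => ?_
    rw [Pi.mul_apply, ← mul_assoc, ← mul_assoc]
    congr 1
    rcases lt_or_ge x 0 with hx | hx
    · simp [gammaPDF_of_neg hx]
    · rw [gammaPDF_of_nonneg hx, gammaPDF_of_nonneg hx, ← ENNReal.ofReal_mul (by positivity),
        ← ENNReal.ofReal_mul ha.le]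
      congr 1
      rcases hx.eq_or_lt with rfl | hx
      · simp [Real.zero_rpow ha.ne']
      · have hG := (Real.Gamma_pos_of_pos ha).ne'
        rw [Real.Gamma_add_one ha.ne', add_sub_cancel_right, Real.rpow_sub_one hx.ne']
        simp only [Real.one_rpow]
        field_simp

/-- Tilting by `exp(s x)` changes the rate from `1` to `1 - s`, which is a dilation by `(1 - s)⁻¹`.
The factor `(1 - s)^(-a)` is the moment generating function. -/
theorem gammaLaw_withDensity_exp {a : ℝ} (ha : 0 ≤ a) {s : ℝ} (hs : s < 1) :
    (gammaLaw a).withDensity (fun x => ENNReal.ofReal (Real.exp (s * x))) =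
      ENNReal.ofReal ((1 - s) ^ (-a)) • (gammaLaw a).map (fun x => (1 - s)⁻¹ * x) := by
  have h1s : 0 < 1 - s := by linarith
  rcases ha.eq_or_lt with rfl | ha
  · classical
    rw [gammaLaw_zero, Measure.map_dirac' (by fun_prop)]
    ext t ht
    rw [withDensity_apply _ ht, setLIntegral_dirac' (by fun_prop) ht]
    simp [ht, indicator]
  · refine Measure.ext_of_lintegral _ fun f hf => ?_
    have hexp : Measurable fun x => ENNReal.ofReal (Real.exp (s * x)) := by fun_prop
    rw [lintegral_withDensity_eq_lintegral_mul _ hexp hf, lintegral_smul_measure,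
      lintegral_map hf (by fun_prop), gammaLaw_of_pos ha, lintegral_gammaMeasure _ _ (hexp.mul hf),
      lintegral_gammaMeasure _ _ (by fun_prop)]
    have hvol := Real.map_volume_mul_left h1s.ne'
    have hg : Measurable fun x => gammaPDF a 1 x * f ((1 - s)⁻¹ * x) :=
      (measurable_gammaPDF _ _).mul (by fun_prop)
    have h2 : ∫⁻ x, gammaPDF a 1 ((1 - s) * x) * f ((1 - s)⁻¹ * ((1 - s) * x)) =
        ENNReal.ofReal |(1 - s)⁻¹| * ∫⁻ x, gammaPDF a 1 x * f ((1 - s)⁻¹ * x) := by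
      rw [← lintegral_map hg (by fun_prop : Measurable fun x : ℝ => (1 - s) * x), hvol,
        lintegral_smul_measure, smul_eq_mul]
    have h3 : ∫⁻ x, gammaPDF a 1 x * f ((1 - s)⁻¹ * x) = ENNReal.ofReal (1 - s) *
        ∫⁻ x, gammaPDF a 1 ((1 - s) * x) * f ((1 - s)⁻¹ * ((1 - s) * x)) := by
      rw [h2, ← mul_assoc, ← ENNReal.ofReal_mul h1s.le, abs_of_pos (inv_pos.2 h1s),
        mul_inv_cancel₀ h1s.ne', ENNReal.ofReal_one, one_mul]
    rw [h3, smul_eq_mul, ← mul_assoc, ← ENNReal.ofReal_mul (by positivity),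
      ← lintegral_const_mul
        (f := fun x => gammaPDF a 1 ((1 - s) * x) * f ((1 - s)⁻¹ * ((1 - s) * x))) _
        (((measurable_gammaPDF _ _).comp (by fun_prop)).mul (by fun_prop))]
    refine lintegral_congr fun x => ?_
    rw [Pi.mul_apply, ← mul_assoc, ← mul_assoc, inv_mul_cancel_left₀ h1s.ne']
    congr 1
    rcases lt_or_ge x 0 with hx | hx
    · simp [gammaPDF_of_neg hx, gammaPDF_of_neg (mul_neg_of_pos_of_neg h1s hx)]
    · rw [gammaPDF_of_nonneg hx, gammaPDF_of_nonneg (by positivity),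
        ← ENNReal.ofReal_mul (by positivity), ← ENNReal.ofReal_mul (by positivity)]
      congr 1
      rw [Real.mul_rpow h1s.le hx, Real.rpow_neg h1s.le, Real.rpow_sub_one h1s.ne']
      have hp : (1 - s) ^ a ≠ 0 := (Real.rpow_pos_of_pos h1s a).ne'
      have he : Real.exp (-(1 * ((1 - s) * x))) = Real.exp (-(1 * x)) * Real.exp (s * x) := by
        rw [← Real.exp_add]; ring_nf
      rw [he]
      field_simp

/-! ### Independent Gamma variables: proportions and total. -/

section Pi

variable {ι : Type*} [Fintype ι]

/-- The tilt by the sum factorises over the coordinates, and the resulting dilation is the same in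
each of them. This is what makes it invisible to `normalize`. -/
theorem pi_gammaLaw_withDensity_exp {a : ι → ℝ} (ha : ∀ i, 0 ≤ a i) {s : ℝ} (hs : s < 1) :
    (Measure.pi fun i => gammaLaw (a i)).withDensity
        (fun g => ENNReal.ofReal (Real.exp (s * ∑ i, g i))) =
      ENNReal.ofReal ((1 - s) ^ (-∑ i, a i)) •
        (Measure.pi fun i => gammaLaw (a i)).map (fun g i => (1 - s)⁻¹ * g i) := by
  have hp := fun i => isProbabilityMeasure_gammaLaw (ha i)
  have h1s : 0 < 1 - s := by linarith
  have : ∀ i, IsProbabilityMeasure ((gammaLaw (a i)).map fun x => (1 - s)⁻¹ * x) := fun i =>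
    Measure.isProbabilityMeasure_map (by fun_prop)
  rw [Measure.pi_map_pi fun i => by fun_prop]
  symm
  have : IsFiniteMeasure (ENNReal.ofReal ((1 - s) ^ (-∑ i, a i)) •
      Measure.pi fun i => (gammaLaw (a i)).map fun x => (1 - s)⁻¹ * x) :=
    Measure.smul_finite _ ENNReal.ofReal_ne_top
  refine ext_of_univ_pi fun t ht => ?_
  have h1 : ∀ g : ι → ℝ, ENNReal.ofReal (Real.exp (s * ∑ i, g i)) =
      ∏ i, ENNReal.ofReal (Real.exp (s * g i)) := fun g => by
    rw [Finset.mul_sum, Real.exp_sum, ENNReal.ofReal_prod_of_nonneg fun i _ => (Real.exp_pos _).le]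
  simp_rw [h1]
  rw [withDensity_pi_univ_pi (fun i => gammaLaw (a i))
    (f := fun _ x => ENNReal.ofReal (Real.exp (s * x))) (fun i => by fun_prop) ht]
  simp_rw [gammaLaw_withDensity_exp (ha _) hs]
  simp only [Measure.smul_apply, Measure.pi_pi, smul_eq_mul]
  rw [Finset.prod_mul_distrib, ← ENNReal.ofReal_prod_of_nonneg fun i _ => by positivity,
    ← Finset.sum_neg_distrib, Real.rpow_sum_of_pos h1s]

/-- The normalization `(g i)ᵢ ↦ (g i / ∑ j, g j)ᵢ`. -/
def normalize (g : ι → ℝ) : ι → ℝ := fun i => g i / ∑ j, g j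

@[fun_prop]
theorem measurable_normalize : Measurable (normalize (ι := ι)) := by
  unfold normalize; fun_prop

theorem normalize_smul (g : ι → ℝ) {c : ℝ} (hc : c ≠ 0) :
    normalize (fun i => c * g i) = normalize g := by
  ext i
  simp only [normalize, ← Finset.mul_sum]
  exact mul_div_mul_left _ _ hc

theorem dirichletDistribution_eq (a : ι → ℝ) :
    dirichletDistribution a = (Measure.pi fun i => gammaLaw (a i)).map normalize := rfl

/-- Independence of proportions and total, without a change of variables. Tilting by `exp(s ∑ g i)`
is, up to a constant, a common dilation and so does not affect events in the proportions. On such an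
event the total therefore has the exponential moments of a multiple of `Gamma(∑ a i)`, and these
determine its law. -/
theorem pi_gammaLaw_map_normalize_sum {a : ι → ℝ} (ha : ∀ i, 0 ≤ a i) :
    (Measure.pi fun i => gammaLaw (a i)).map (fun g => (normalize g, ∑ i, g i)) =
      (dirichletDistribution a).prod (gammaLaw (∑ i, a i)) := by
  have hp := fun i => isProbabilityMeasure_gammaLaw (ha i)
  have hA : 0 ≤ ∑ i, a i := Finset.sum_nonneg fun i _ => ha i
  have := isProbabilityMeasure_gammaLaw hA
  have := isProbabilityMeasure_dirichletDistribution ha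
  have hsum : Measurable fun g : ι → ℝ => ∑ i, g i := by fun_prop
  set γ := Measure.pi fun i => gammaLaw (a i)
  symm
  refine Measure.prod_eq fun H t hH ht => ?_
  have hH' : MeasurableSet (normalize ⁻¹' H) := measurable_normalize hH
  have key : (γ.restrict (normalize ⁻¹' H)).map (fun g => ∑ i, g i) =
      γ (normalize ⁻¹' H) • gammaLaw (∑ i, a i) := by
    have : IsFiniteMeasure (γ (normalize ⁻¹' H) • gammaLaw (∑ i, a i)) :=
      Measure.smul_finite _ (measure_ne_top _ _)
    have hL : ∀ s < 1, ∫⁻ x, ENNReal.ofReal (Real.exp (s * x))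
        ∂((γ.restrict (normalize ⁻¹' H)).map fun g => ∑ i, g i) =
        ENNReal.ofReal ((1 - s) ^ (-∑ i, a i)) * γ (normalize ⁻¹' H) := by
      intro s hs
      have h1s : (1 - s)⁻¹ ≠ 0 := inv_ne_zero (by linarith)
      rw [lintegral_map (by fun_prop) hsum, ← withDensity_apply _ hH',
        pi_gammaLaw_withDensity_exp ha hs, Measure.smul_apply, smul_eq_mul,
        Measure.map_apply (by fun_prop) hH']
      congr 2
      ext g
      simp only [mem_preimage, normalize_smul g h1s]
    refine ext_of_lintegral_exp (fun s hs => ?_) (fun s hs => ?_)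
    · rw [hL s hs]
      exact ENNReal.mul_ne_top ENNReal.ofReal_ne_top (measure_ne_top _ _)
    · rw [hL s hs, lintegral_smul_measure, smul_eq_mul, mul_comm]
      congr 1
      have h2 := congrArg (fun m => m univ) (gammaLaw_withDensity_exp hA hs)
      simp only [withDensity_apply _ MeasurableSet.univ, Measure.smul_apply, smul_eq_mul,
        setLIntegral_univ] at h2
      rw [h2, Measure.map_apply (by fun_prop) MeasurableSet.univ]
      simp
  rw [Measure.map_apply (measurable_normalize.prodMk hsum) (hH.prod ht), dirichletDistribution_eq,
    Measure.map_apply measurable_normalize hH]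
  have h3 := congrArg (fun m => m t) key
  simp only [Measure.smul_apply, smul_eq_mul] at h3
  rw [← h3, Measure.map_apply hsum ht, Measure.restrict_apply (hsum ht), inter_comm]
  rfl

theorem pi_gammaLaw_map_sum {a : ι → ℝ} (ha : ∀ i, 0 ≤ a i) :
    (Measure.pi fun i => gammaLaw (a i)).map (fun g => ∑ i, g i) = gammaLaw (∑ i, a i) := by
  have := isProbabilityMeasure_gammaLaw (Finset.sum_nonneg fun i (_ : i ∈ Finset.univ) => ha i)
  have := isProbabilityMeasure_dirichletDistribution ha
  have h := congrArg Measure.snd (pi_gammaLaw_map_normalize_sum ha)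
  rw [Measure.snd_prod, Measure.snd, Measure.map_map measurable_snd
    (measurable_normalize.prodMk (by fun_prop))] at h
  exact h

end Pi

/-! ### Size biasing and stick breaking for Dirichlet vectors. -/

section Pi

variable {ι : Type*}

theorem lintegral_mul_gammaLaw {a : ℝ} (ha : 0 ≤ a) :
    ∫⁻ x, ENNReal.ofReal x ∂(gammaLaw a) = ENNReal.ofReal a := by
  have := isProbabilityMeasure_gammaLaw (by linarith : 0 ≤ a + 1)
  have h := congrArg (fun m => m univ) (gammaLaw_withDensity_id ha)
  simpa [withDensity_apply _ MeasurableSet.univ] using h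

theorem nonneg_add_single [DecidableEq ι] {a : ι → ℝ} (ha : ∀ i, 0 ≤ a i) (i : ι) :
    ∀ j, 0 ≤ (a + Pi.single i 1 : ι → ℝ) j := fun j => by
  have : (0 : ι → ℝ) ≤ Pi.single i 1 := Pi.single_nonneg.2 zero_le_one
  exact add_nonneg (ha j) (this j)

variable [Fintype ι]

theorem pi_gammaLaw_nonneg_ae {a : ι → ℝ} (ha : ∀ i, 0 ≤ a i) :
    ∀ᵐ g ∂(Measure.pi fun i => gammaLaw (a i)), ∀ i, 0 ≤ g i := by
  have hp := fun i => isProbabilityMeasure_gammaLaw (ha i)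
  refine ae_all_iff.2 fun i => ?_
  exact (measurePreserving_eval (fun i => gammaLaw (a i)) i).quasiMeasurePreserving.ae
    (gammaLaw_nonneg (a i))

theorem sum_pos_ae {a : ι → ℝ} (ha : ∀ i, 0 ≤ a i) (hA : 0 < ∑ i, a i) :
    ∀ᵐ g ∂(Measure.pi fun i => gammaLaw (a i)), 0 < ∑ i, g i := by
  have h := gammaLaw_pos hA
  rw [← pi_gammaLaw_map_sum ha] at h
  exact ae_of_ae_map (by fun_prop) h

variable [DecidableEq ι]

theorem pi_gammaLaw_withDensity_apply {a : ι → ℝ} (ha : ∀ i, 0 ≤ a i) (i : ι) :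
    (Measure.pi fun i => gammaLaw (a i)).withDensity (fun g => ENNReal.ofReal (g i)) =
      ENNReal.ofReal (a i) • Measure.pi fun j => gammaLaw ((a + Pi.single i 1 : ι → ℝ) j) := by
  have hp := fun i => isProbabilityMeasure_gammaLaw (ha i)
  have hp' := fun j => isProbabilityMeasure_gammaLaw (nonneg_add_single ha i j)
  symm
  have : IsFiniteMeasure (ENNReal.ofReal (a i) •
      Measure.pi fun j => gammaLaw ((a + Pi.single i 1 : ι → ℝ) j)) :=
    Measure.smul_finite _ ENNReal.ofReal_ne_top
  refine ext_of_univ_pi fun t ht => ?_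
  have h1 : ∀ g : ι → ℝ, ENNReal.ofReal (g i) =
      ∏ j, (if j = i then ENNReal.ofReal (g j) else 1) := fun g => by
    rw [Finset.prod_ite_eq' Finset.univ i]; simp
  rw [show (fun g : ι → ℝ => ENNReal.ofReal (g i)) = _ from funext h1,
    withDensity_pi_univ_pi (fun i => gammaLaw (a i))
      (f := fun j x => if j = i then ENNReal.ofReal x else 1)
      (fun j => by split_ifs <;> fun_prop) ht, Measure.smul_apply, Measure.pi_pi, smul_eq_mul]
  refine (congrArg _ (Finset.mul_prod_erase _ _ (Finset.mem_univ i)).symm).trans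
    (Eq.trans ?_ (Finset.mul_prod_erase _ _ (Finset.mem_univ i)))
  rw [← mul_assoc]
  congr 1
  · simp only [if_true, Pi.add_apply, Pi.single_eq_same]
    rw [← smul_eq_mul, ← Measure.smul_apply, ← gammaLaw_withDensity_id (ha i)]
  · refine Finset.prod_congr rfl fun j hj => ?_
    have hji := Finset.ne_of_mem_erase hj
    simp [hji, ← Pi.one_def]

/-- Size biasing the Dirichlet distribution in coordinate `i` raises the `i`-th parameter by one. -/
theorem lintegral_apply_mul_dirichletDistribution {a : ι → ℝ} (ha : ∀ i, 0 ≤ a i)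
    (hA : 0 < ∑ i, a i) (i : ι) {f : (ι → ℝ) → ℝ≥0∞} (hf : Measurable f) :
    ENNReal.ofReal (∑ i, a i) * ∫⁻ p, ENNReal.ofReal (p i) * f p ∂(dirichletDistribution a) =
      ENNReal.ofReal (a i) * ∫⁻ p, f p ∂(dirichletDistribution (a + Pi.single i 1)) := by
  have hp := fun i => isProbabilityMeasure_gammaLaw (ha i)
  have hp' := isProbabilityMeasure_gammaLaw hA.le
  have hd := isProbabilityMeasure_dirichletDistribution ha
  have hm : Measurable fun p : ι → ℝ => ENNReal.ofReal (p i) * f p := by fun_prop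
  have hn := measurable_normalize (ι := ι)
  have hs : Measurable fun g : ι → ℝ => ∑ i, g i := by fun_prop
  have hF : Measurable fun q : (ι → ℝ) × ℝ =>
      ENNReal.ofReal q.2 * (ENNReal.ofReal (q.1 i) * f q.1) := by fun_prop
  -- The constant `∑ a i` is the mean of an independent total. Total times `p i` is the Gamma
  -- variable `g i`, so size biasing the proportions becomes size biasing a single Gamma factor.
  calc ENNReal.ofReal (∑ i, a i) * ∫⁻ p, ENNReal.ofReal (p i) * f p ∂(dirichletDistribution a)
      = ∫⁻ q, ENNReal.ofReal q.2 * (ENNReal.ofReal (q.1 i) * f q.1)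
          ∂((dirichletDistribution a).prod (gammaLaw (∑ i, a i))) := by
        rw [lintegral_prod _ hF.aemeasurable]
        have h1 : ∀ p : ι → ℝ, ∫⁻ x, ENNReal.ofReal x * (ENNReal.ofReal (p i) * f p)
            ∂(gammaLaw (∑ i, a i)) =
            ENNReal.ofReal (∑ i, a i) * (ENNReal.ofReal (p i) * f p) := fun p => by
          rw [lintegral_mul_const _ (by fun_prop), lintegral_mul_gammaLaw hA.le]
        simp_rw [h1]
        rw [lintegral_const_mul _ hm]
    _ = ∫⁻ g, ENNReal.ofReal (g i) * f (normalize g) ∂(Measure.pi fun i => gammaLaw (a i)) := by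
        rw [← pi_gammaLaw_map_normalize_sum ha, lintegral_map hF (hn.prodMk hs)]
        refine lintegral_congr_ae ?_
        filter_upwards [pi_gammaLaw_nonneg_ae ha, sum_pos_ae ha hA] with g h1 h2
        rw [← mul_assoc, ← ENNReal.ofReal_mul h2.le]
        congr 2
        simp only [normalize]
        field_simp
    _ = _ := by
        rw [dirichletDistribution_eq, lintegral_map hf hn, ← smul_eq_mul (ENNReal.ofReal (a i)),
          ← lintegral_smul_measure, ← pi_gammaLaw_withDensity_apply ha i,
          lintegral_withDensity_eq_lintegral_mul _ (by fun_prop)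
            (by fun_prop : Measurable fun g => f (normalize g))]
        rfl

theorem gammaLaw_conv_one {a : ℝ} (ha : 0 ≤ a) :
    ((gammaLaw a).prod (gammaLaw 1)).map (fun p => p.1 + p.2) = gammaLaw (a + 1) := by
  have := isProbabilityMeasure_gammaLaw ha
  have := isProbabilityMeasure_gammaLaw (zero_le_one' ℝ)
  have := isProbabilityMeasure_gammaLaw (by linarith : 0 ≤ a + 1)
  have hexp : ∀ {b : ℝ}, 0 ≤ b → ∀ s < 1, ∫⁻ x, ENNReal.ofReal (Real.exp (s * x)) ∂(gammaLaw b) =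
      ENNReal.ofReal ((1 - s) ^ (-b)) := by
    intro b hb s hs
    have := isProbabilityMeasure_gammaLaw hb
    have h2 := congrArg (fun m => m univ) (gammaLaw_withDensity_exp hb hs)
    simp only [withDensity_apply _ MeasurableSet.univ, Measure.smul_apply, smul_eq_mul,
      setLIntegral_univ] at h2
    rw [h2, Measure.map_apply (by fun_prop) MeasurableSet.univ]
    simp
  have hL : ∀ s < 1, ∫⁻ x, ENNReal.ofReal (Real.exp (s * x))
      ∂(((gammaLaw a).prod (gammaLaw 1)).map fun p => p.1 + p.2) =
      ENNReal.ofReal ((1 - s) ^ (-(a + 1))) := by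
    intro s hs
    rw [lintegral_map (by fun_prop) (by fun_prop)]
    simp_rw [mul_add, Real.exp_add, ENNReal.ofReal_mul (Real.exp_pos _).le]
    rw [lintegral_prod_mul (f := fun x => ENNReal.ofReal (Real.exp (s * x)))
      (g := fun x => ENNReal.ofReal (Real.exp (s * x))) (by fun_prop) (by fun_prop), hexp ha s hs, hexp zero_le_one s hs,
      ← ENNReal.ofReal_mul (by have : 0 < 1 - s := by linarith
                               positivity), ← Real.rpow_add (by linarith)]
    ring_nf
  refine ext_of_lintegral_exp (fun s hs => ?_) (fun s hs => ?_)
  · rw [hL s hs]; exact ENNReal.ofReal_ne_top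
  · rw [hL s hs, hexp (by linarith) s hs]

theorem pi_gammaLaw_prod_map_add_single {a : ι → ℝ} (ha : ∀ i, 0 ≤ a i) (i : ι) :
    ((Measure.pi fun i => gammaLaw (a i)).prod (gammaLaw 1)).map
        (fun p => p.1 + Pi.single i p.2) =
      Measure.pi fun j => gammaLaw ((a + Pi.single i 1 : ι → ℝ) j) := by
  have hp := fun i => isProbabilityMeasure_gammaLaw (ha i)
  have hp1 := isProbabilityMeasure_gammaLaw (zero_le_one' ℝ)
  have hp' := fun j => isProbabilityMeasure_gammaLaw (nonneg_add_single ha i j)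
  have hmeas : Measurable fun p : (ι → ℝ) × ℝ => p.1 + (Pi.single i p.2 : ι → ℝ) := by
    refine measurable_pi_lambda _ fun j => ?_
    rcases eq_or_ne j i with rfl | h
    · simp only [Pi.add_apply, Pi.single_eq_same]; fun_prop
    · simp only [Pi.add_apply, Pi.single_eq_of_ne h]; fun_prop
  symm
  refine ext_of_univ_pi fun t ht => ?_
  rw [Measure.pi_pi, Measure.map_apply hmeas (.univ_pi ht),
    Measure.prod_apply_symm (hmeas (.univ_pi ht))]
  have h1 : ∀ y : ℝ, (fun x => (x, y)) ⁻¹'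
      ((fun p : (ι → ℝ) × ℝ => p.1 + (Pi.single i p.2 : ι → ℝ)) ⁻¹' univ.pi t) =
      univ.pi (Function.update t i ((fun x => x + y) ⁻¹' t i)) := by
    intro y
    ext x
    simp only [mem_preimage, Set.mem_pi, mem_univ, true_implies]
    refine forall_congr' fun j => ?_
    rcases eq_or_ne j i with rfl | h
    · simp
    · simp [h]
  simp_rw [h1, Measure.pi_pi, ← Finset.mul_prod_erase _ _ (Finset.mem_univ i),
    Function.update_self]
  have h2 : ∀ y : ℝ, ∏ j ∈ Finset.univ.erase i,
      gammaLaw (a j) (Function.update t i ((fun x => x + y) ⁻¹' t i) j) =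
      ∏ j ∈ Finset.univ.erase i, gammaLaw ((a + Pi.single i 1 : ι → ℝ) j) (t j) := fun y =>
    Finset.prod_congr rfl fun j hj => by
      have hji := Finset.ne_of_mem_erase hj
      simp [hji]
  simp_rw [h2]
  have hadd : Measurable fun p : ℝ × ℝ => p.1 + p.2 := by fun_prop
  rw [lintegral_mul_const']
  · congr 1
    rw [Pi.add_apply, Pi.single_eq_same, ← gammaLaw_conv_one (ha i), Measure.map_apply hadd (ht i),
      Measure.prod_apply_symm (hadd (ht i))]
    rfl
  · exact ENNReal.prod_ne_top fun j _ => measure_ne_top _ _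

/-- The Beta distribution with parameters `1` and `c`. -/
def betaLaw (c : ℝ) : Measure ℝ :=
  ((gammaLaw c).prod (gammaLaw 1)).map fun p => p.2 / (p.1 + p.2)

theorem isProbabilityMeasure_betaLaw {c : ℝ} (hc : 0 ≤ c) : IsProbabilityMeasure (betaLaw c) := by
  have := isProbabilityMeasure_gammaLaw hc
  have := isProbabilityMeasure_gammaLaw (zero_le_one' ℝ)
  exact Measure.isProbabilityMeasure_map (by fun_prop)

theorem betaLaw_mem_Icc {c : ℝ} (hc : 0 ≤ c) : ∀ᵐ b ∂(betaLaw c), b ∈ Icc (0 : ℝ) 1 := by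
  have := isProbabilityMeasure_gammaLaw hc
  have := isProbabilityMeasure_gammaLaw (zero_le_one' ℝ)
  rw [betaLaw]
  refine (ae_map_iff (p := fun b => b ∈ Icc (0 : ℝ) 1) (by fun_prop) measurableSet_Icc).2 ?_
  filter_upwards [Measure.quasiMeasurePreserving_fst.ae (gammaLaw_nonneg c),
    Measure.quasiMeasurePreserving_snd.ae (gammaLaw_nonneg 1)] with p h1 h2
  exact ⟨by positivity, div_le_one_of_le₀ (by linarith) (by linarith)⟩

/-- Stick breaking for Dirichlet distributions. -/
theorem dirichletDistribution_prod_betaLaw_map {a : ι → ℝ} (ha : ∀ i, 0 ≤ a i)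
    (hA : 0 < ∑ i, a i) (i : ι) :
    ((dirichletDistribution a).prod (betaLaw (∑ i, a i))).map
        (fun q => q.2 • (Pi.single i 1 : ι → ℝ) + (1 - q.2) • q.1) =
      dirichletDistribution (a + Pi.single i 1) := by
  have hp := fun i => isProbabilityMeasure_gammaLaw (ha i)
  have hp1 := isProbabilityMeasure_gammaLaw (zero_le_one' ℝ)
  have hp' := isProbabilityMeasure_gammaLaw hA.le
  have hd := isProbabilityMeasure_dirichletDistribution ha
  have hb := isProbabilityMeasure_betaLaw hA.le
  have hn := measurable_normalize (ι := ι)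
  have hs : Measurable fun g : ι → ℝ => ∑ i, g i := by fun_prop
  have hsingle : Measurable fun x : ℝ => (Pi.single i x : ι → ℝ) :=
    measurable_pi_lambda _ fun j => by
      rcases eq_or_ne j i with rfl | h
      · simp only [Pi.single_eq_same]; fun_prop
      · simp only [Pi.single_eq_of_ne h]; fun_prop
  refine Measure.ext_of_lintegral _ fun f hf => ?_
  have hmix : Measurable fun q : (ι → ℝ) × ℝ =>
      q.2 • (Pi.single i 1 : ι → ℝ) + (1 - q.2) • q.1 := by fun_prop
  rw [lintegral_map hf hmix, lintegral_prod _
    (by fun_prop : AEMeasurable (fun q : (ι → ℝ) × ℝ =>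
      f (q.2 • (Pi.single i 1 : ι → ℝ) + (1 - q.2) • q.1)) _)]
  have hF : Measurable fun q : ((ι → ℝ) × ℝ) × ℝ =>
      f ((q.2 / (q.1.2 + q.2)) • (Pi.single i 1 : ι → ℝ) +
        (1 - q.2 / (q.1.2 + q.2)) • q.1.1) := by fun_prop
  -- Write `b = h / (x + h)` with `x ∼ Gamma(∑ a i)` and take `x` to be the total belonging to the
  -- proportions `p`, from which it is independent. The mixture is then the normalisation of `g + h
  -- e_i`.
  calc ∫⁻ p, ∫⁻ b, f (b • (Pi.single i 1 : ι → ℝ) + (1 - b) • p) ∂(betaLaw (∑ i, a i))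
        ∂(dirichletDistribution a)
      = ∫⁻ p, ∫⁻ x, ∫⁻ h, f ((h / (x + h)) • (Pi.single i 1 : ι → ℝ) + (1 - h / (x + h)) • p)
          ∂(gammaLaw 1) ∂(gammaLaw (∑ i, a i)) ∂(dirichletDistribution a) := by
        refine lintegral_congr fun p => ?_
        rw [betaLaw, lintegral_map (by fun_prop) (by fun_prop), lintegral_prod _ (by fun_prop)]
    _ = ∫⁻ q, ∫⁻ h, f ((h / (q.2 + h)) • (Pi.single i 1 : ι → ℝ) + (1 - h / (q.2 + h)) • q.1)
          ∂(gammaLaw 1) ∂((dirichletDistribution a).prod (gammaLaw (∑ i, a i))) := by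
        rw [lintegral_prod _ hF.lintegral_prod_right'.aemeasurable]
    _ = ∫⁻ g, ∫⁻ h, f (normalize (g + Pi.single i h)) ∂(gammaLaw 1)
          ∂(Measure.pi fun i => gammaLaw (a i)) := by
        rw [← pi_gammaLaw_map_normalize_sum ha,
          lintegral_map hF.lintegral_prod_right' (hn.prodMk hs)]
        refine lintegral_congr_ae ?_
        filter_upwards [sum_pos_ae ha hA] with g h2
        refine lintegral_congr_ae ?_
        filter_upwards [gammaLaw_nonneg 1] with h h3
        congr 1
        ext j
        have h4 : ∑ j, g j + h ≠ 0 := by positivity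
        simp only [normalize, Pi.add_apply, Pi.smul_apply, smul_eq_mul, Finset.sum_add_distrib,
          Finset.sum_pi_single', Finset.mem_univ, if_true]
        rcases eq_or_ne j i with rfl | hj
        · simp only [Pi.single_eq_same]; field_simp; ring
        · simp only [Pi.single_eq_of_ne hj]; field_simp; ring
    _ = _ := by
        rw [dirichletDistribution_eq, ← pi_gammaLaw_prod_map_add_single ha i,
          lintegral_map hf hn, lintegral_map (by fun_prop : Measurable fun g => f (normalize g)) (by fun_prop),
          lintegral_prod _ (by fun_prop)]

end Pi

/-! ### Dirichlet processes -/

section DirichletProcess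

variable {X : Type*} [MeasurableSpace X]

theorem measurable_coe_apply {s : Set X} (hs : MeasurableSet s) :
    Measurable fun ν : ProbabilityMeasure X => (ν : Measure X) s :=
  (Measure.measurable_coe hs).comp measurable_subtype_coe

theorem measurable_real_apply {s : Set X} (hs : MeasurableSet s) :
    Measurable fun ν : ProbabilityMeasure X => (ν : Measure X).real s :=
  (measurable_coe_apply hs).ennreal_toReal

/-- The masses that a probability measure gives to the fibres of `c`. -/
def fiberMass {ι : Type*} (c : X → ι) (ν : ProbabilityMeasure X) : ι → ℝ :=
  fun i => (ν : Measure X).real (c ⁻¹' {i})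

@[fun_prop]
theorem measurable_fiberMass {ι : Type*} [MeasurableSpace ι] [MeasurableSingletonClass ι]
    {c : X → ι} (hc : Measurable c) : Measurable (fiberMass c) :=
  measurable_pi_lambda _ fun i => measurable_real_apply (hc (measurableSet_singleton i))

theorem sum_measureReal_fiber {ι : Type*} [Fintype ι] [MeasurableSpace ι]
    [MeasurableSingletonClass ι] {c : X → ι} (hc : Measurable c) (m : Measure X)
    [IsFiniteMeasure m] (I : Finset ι) :
    ∑ i ∈ I, m.real (c ⁻¹' {i}) = m.real (c ⁻¹' I) :=
  sum_measureReal_preimage_singleton I fun i _ => hc (measurableSet_singleton i)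

/-- The σ-algebra on probability measures is generated by the evaluations: the identity is already
measurable for the σ-algebra pulled back along all of them. -/
theorem exists_preimage_real_apply_eq {u : Set (ProbabilityMeasure X)} (hs : MeasurableSet u) :
    ∃ t, MeasurableSet t ∧
      (fun (ν : ProbabilityMeasure X) (s : {s : Set X // MeasurableSet s}) =>
        (ν : Measure X).real s) ⁻¹' t = u := by
  set f := fun (ν : ProbabilityMeasure X) (s : {s : Set X // MeasurableSet s}) =>
    (ν : Measure X).real s with hf
  have h1 : @Measurable _ _ (MeasurableSpace.comap f inferInstance) _ f := comap_measurable f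
  have h2 : @Measurable _ _ (MeasurableSpace.comap f inferInstance) _
      (id : ProbabilityMeasure X → ProbabilityMeasure X) := by
    refine @Measurable.subtype_mk _ _ (MeasurableSpace.comap f inferInstance) _ _
      (fun ν => (ν : Measure X)) ?_ (fun ν => ν.2)
    refine @Measure.measurable_of_measurable_coe _ _ _ (MeasurableSpace.comap f inferInstance)
      _ fun s hs => ?_
    have h3 : (fun ν : ProbabilityMeasure X => (ν : Measure X) s) =
        fun ν => ENNReal.ofReal (f ν ⟨s, hs⟩) := by
      ext ν
      simp [hf]
    rw [h3]
    exact ENNReal.measurable_ofReal.comp ((measurable_pi_apply _).comp h1)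
  exact h2 hs

theorem ext_of_map_real_apply {m₁ m₂ : Measure (ProbabilityMeasure X)} [IsFiniteMeasure m₁]
    (h : ∀ I : Finset {s : Set X // MeasurableSet s},
      m₁.map (fun (ν : ProbabilityMeasure X) (s : I) => (ν : Measure X).real s.1) =
        m₂.map (fun (ν : ProbabilityMeasure X) (s : I) => (ν : Measure X).real s.1)) : m₁ = m₂ := by
  set f := fun (ν : ProbabilityMeasure X) (s : {s : Set X // MeasurableSet s}) =>
    (ν : Measure X).real s with hf
  have hfm : Measurable f := measurable_pi_lambda _ fun s => measurable_real_apply s.2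
  have hr : ∀ (m : Measure (ProbabilityMeasure X)) (I : Finset {s : Set X // MeasurableSet s}),
      (m.map f).map I.restrict = m.map (fun (ν : ProbabilityMeasure X) (s : I) => (ν : Measure X).real s.1) := by
    intro m I
    rw [Measure.map_map (by fun_prop) hfm]
    rfl
  have key : m₁.map f = m₂.map f := by
    have : ∀ I : Finset {s : Set X // MeasurableSet s}, IsFiniteMeasure
      (m₁.map (fun (ν : ProbabilityMeasure X) (s : I) => (ν : Measure X).real s.1)) := fun I => inferInstance
    exact IsProjectiveLimit.unique
      (P := fun I : Finset {s : Set X // MeasurableSet s} => m₁.map (fun (ν : ProbabilityMeasure X) (s : I) => (ν : Measure X).real s.1))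
      (fun I => hr m₁ I) (fun I => (hr m₂ I).trans (h I).symm)
  ext s hs
  obtain ⟨t, ht, rfl⟩ := exists_preimage_real_apply_eq hs
  rw [← Measure.map_apply hfm ht, ← Measure.map_apply hfm ht, key]

/-- A finite measure on probability measures is determined by the laws of the masses of the cells
of finite measurable partitions, even if only those refining a given set are considered. -/
theorem ext_of_map_fiberMass {m₁ m₂ : Measure (ProbabilityMeasure X)} [IsFiniteMeasure m₁]
    {C : Set X} (hC : MeasurableSet C)
    (h : ∀ (d : ℕ) (c : X → Fin (d + 1)), Measurable c → ∀ I : Finset (Fin (d + 1)),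
      C = c ⁻¹' I → m₁.map (fiberMass c) = m₂.map (fiberMass c)) : m₁ = m₂ := by
  classical
  refine ext_of_map_real_apply fun J => ?_
  let s : Option J → Set X := fun o => o.elim C fun j => j.1
  have hs : ∀ o, MeasurableSet (s o) := by
    rintro (_ | j)
    · exact hC
    · exact j.1.2
  -- The map records in which of the sets of `J`, and in `C` (the index `none`), a point lies. Its
  -- fibres are the atoms, and each of these sets is a union of atoms.
  let c₀ : X → (Option J → Bool) := fun x o => decide (x ∈ s o)
  have hc₀ : Measurable c₀ := measurable_pi_lambda _ fun o => by
    refine measurable_to_bool ?_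
    have : (fun x => c₀ x o) ⁻¹' {true} = s o := by ext x; simp [c₀]
    rw [this]
    exact hs o
  obtain ⟨d, hd⟩ : ∃ d, Fintype.card (Option J → Bool) = d + 1 :=
    Nat.exists_eq_succ_of_ne_zero Fintype.card_ne_zero
  let e : (Option J → Bool) ≃ Fin (d + 1) := Fintype.equivFinOfCardEq hd
  have hc : Measurable (e ∘ c₀) := (measurable_of_countable e).comp hc₀
  let T : Option J → Finset (Fin (d + 1)) := fun o => {i | e.symm i o = true}
  have hT : ∀ o, s o = (e ∘ c₀) ⁻¹' (T o) := by
    intro o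
    ext x
    simp [T, c₀]
  have h1 := h d (e ∘ c₀) hc (T none) (hT none)
  have h2 : (fun (ν : ProbabilityMeasure X) (j : J) => (ν : Measure X).real j.1) =
      (fun p j => ∑ i ∈ T (some j), p i) ∘ fiberMass (e ∘ c₀) := by
    ext ν j
    simp only [Function.comp_apply, fiberMass]
    rw [sum_measureReal_fiber hc, ← hT]
    rfl
  rw [h2, ← Measure.map_map (by fun_prop) (by fun_prop), h1,
    Measure.map_map (by fun_prop) (by fun_prop)]

/-- Partitions are encoded from here on as the fibres of measurable maps to `Fin (d + 1)`; a fibre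
may be empty. -/
theorem IsDirichletLaw.map_fiberMass {α : Measure X} {D : Measure (ProbabilityMeasure X)}
    (h : IsDirichletLaw α D) {d : ℕ} {c : X → Fin (d + 1)} (hc : Measurable c) :
    D.map (fiberMass c) = dirichletDistribution fun i => α.real (c ⁻¹' {i}) := by
  refine h d (fun i => c ⁻¹' {i}) (fun i => hc (measurableSet_singleton i)) ?_ ?_
  · intro i j hij
    exact Disjoint.preimage _ (by simpa using hij)
  · ext x; simp

theorem isDirichletLaw_of_map_fiberMass {α : Measure X} {D : Measure (ProbabilityMeasure X)}
    (h : ∀ (d : ℕ) (c : X → Fin (d + 1)), Measurable c →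
      D.map (fiberMass c) = dirichletDistribution fun i => α.real (c ⁻¹' {i})) :
    IsDirichletLaw α D := by
  intro d B hB hdisj hun
  choose c hc using fun x : X => mem_iUnion.1 (hun ▸ mem_univ x : x ∈ ⋃ i, B i)
  have hcB : ∀ i, c ⁻¹' {i} = B i := by
    intro i
    ext x
    refine ⟨fun hx => ?_, fun hx => ?_⟩
    · have : c x = i := hx
      exact this ▸ hc x
    · by_contra hne
      exact disjoint_left.1 (hdisj hne) (hc x) hx
  have hcm : Measurable c := measurable_to_countable' fun i => by rw [hcB]; exact hB i
  have h1 := h d c hcm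
  simp only [hcB] at h1
  rw [← h1]
  congr 1
  ext ν i
  simp [fiberMass, hcB]

theorem IsDirichletLaw.unique {α : Measure X} {D D' : Measure (ProbabilityMeasure X)}
    (h : IsDirichletLaw α D) (h' : IsDirichletLaw α D') : D = D' := by
  have := h.isProbabilityMeasure
  exact ext_of_map_fiberMass MeasurableSet.univ fun d c hc _ _ => by
    rw [h.map_fiberMass hc, h'.map_fiberMass hc]

theorem IsDirichletLaw.dirichletLaw_eq {α : Measure X} {D : Measure (ProbabilityMeasure X)}
    (h : IsDirichletLaw α D) : dirichletLaw α = D := by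
  have hex : ∃ D, IsDirichletLaw α D := ⟨D, h⟩
  rw [dirichletLaw, dif_pos hex]
  exact hex.choose_spec.unique h

theorem isDirichletLaw_dirichletLaw {α : Measure X} (h : dirichletLaw α ≠ 0) :
    IsDirichletLaw α (dirichletLaw α) := by
  unfold dirichletLaw at h ⊢
  split_ifs at h ⊢ with hex
  · exact hex.choose_spec
  · exact absurd rfl h

/-- Consider the partition into one cell. The random measure gives it mass `1`, whereas parameter
`0` gives the point mass at `0`, because `0 / 0 = 0`. As `Measure.real` sends `∞` to `0`, infinite
`α` is excluded as well. -/
theorem IsDirichletLaw.real_univ_pos {α : Measure X} {D : Measure (ProbabilityMeasure X)}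
    (h : IsDirichletLaw α D) : 0 < α.real univ := by
  refine measureReal_nonneg.lt_of_ne' fun h0 => ?_
  have := h.isProbabilityMeasure
  have h1 := h.map_fiberMass (c := fun _ => (0 : Fin (0 + 1))) measurable_const
  have h2 : fiberMass (fun _ : X => (0 : Fin (0 + 1))) = fun _ _ => 1 := by
    ext ν i
    have : (fun _ : X => (0 : Fin (0 + 1))) ⁻¹' {i} = univ := by
      ext x; simpa using (Subsingleton.elim (α := Fin 1) 0 i)
    simp [fiberMass, this]
  have h3 : ∀ i : Fin (0 + 1), α.real ((fun _ : X => (0 : Fin (0 + 1))) ⁻¹' {i}) = 0 := by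
    intro i
    have : (fun _ : X => (0 : Fin (0 + 1))) ⁻¹' {i} = univ := by
      ext x; simpa using (Subsingleton.elim (α := Fin 1) 0 i)
    rw [this, h0]
  simp only [h3] at h1
  rw [h2, Measure.map_const, measure_univ, one_smul, dirichletDistribution_eq, gammaLaw_zero,
    ← Measure.infinitePi_eq_pi, Measure.infinitePi_dirac, Measure.map_dirac' measurable_normalize]
    at h1
  have h4 := congrArg (fun m => m {fun _ => 0}) h1
  have h5 : (fun _ : Fin (0 + 1) => (1 : ℝ)) ≠ fun _ => 0 := fun h => by
    simpa using congrFun h 0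
  simp only [Measure.dirac_apply' _ (measurableSet_singleton _)] at h4
  rw [indicator_of_notMem (by simpa using h5), indicator_of_mem] at h4
  · simp at h4
  · ext i; simp [normalize]

theorem IsDirichletLaw.isFiniteMeasure {α : Measure X} {D : Measure (ProbabilityMeasure X)}
    (h : IsDirichletLaw α D) : IsFiniteMeasure α := by
  refine ⟨lt_top_iff_ne_top.2 fun h0 => ?_⟩
  have := h.real_univ_pos
  simp [measureReal_def, h0] at this

/-- `b δ_x + (1 - b) ν`, where `b` is clamped to `[0, 1]`. -/
def mixDirac (b : ℝ) (x : X) (ν : ProbabilityMeasure X) : ProbabilityMeasure X :=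
  ⟨min (ENNReal.ofReal b) 1 • Measure.dirac x + (1 - min (ENNReal.ofReal b) 1) • (ν : Measure X),
    ⟨by simp⟩⟩

theorem mixDirac_real {b : ℝ} (hb : b ∈ Icc (0 : ℝ) 1) (x : X) (ν : ProbabilityMeasure X)
    {s : Set X} (hs : MeasurableSet s) :
    (mixDirac b x ν : Measure X).real s =
      b * s.indicator 1 x + (1 - b) * (ν : Measure X).real s := by
  have h1 : min (ENNReal.ofReal b) 1 = ENNReal.ofReal b :=
    min_eq_left (by simpa using ENNReal.ofReal_le_ofReal hb.2)
  have h2 : 1 - ENNReal.ofReal b = ENNReal.ofReal (1 - b) := by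
    rw [ENNReal.ofReal_sub _ hb.1, ENNReal.ofReal_one]
  rw [mixDirac, ProbabilityMeasure.coe_mk, h1, h2, measureReal_def, Measure.add_apply,
    Measure.smul_apply, Measure.smul_apply, Measure.dirac_apply' _ hs, smul_eq_mul, smul_eq_mul,
    ENNReal.toReal_add, ENNReal.toReal_mul, ENNReal.toReal_mul, ENNReal.toReal_ofReal hb.1,
    ENNReal.toReal_ofReal (by linarith [hb.2]), measureReal_def]
  · congr 2
    by_cases hx : x ∈ s <;> simp [hx]
  · exact ENNReal.mul_ne_top ENNReal.ofReal_ne_top (by by_cases hx : x ∈ s <;> simp [hx])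
  · exact ENNReal.mul_ne_top ENNReal.ofReal_ne_top (measure_ne_top _ _)

@[fun_prop]
theorem measurable_mixDirac :
    Measurable fun q : (X × ProbabilityMeasure X) × ℝ => mixDirac q.2 q.1.1 q.1.2 := by
  refine Measurable.subtype_mk (Measure.measurable_of_measurable_coe _ fun s hs => ?_)
  simp only [Measure.add_apply, Measure.smul_apply, smul_eq_mul, Measure.dirac_apply' _ hs]
  have h1 : Measurable (s.indicator (1 : X → ℝ≥0∞)) := measurable_one.indicator hs
  have h2 := measurable_coe_apply hs
  fun_prop

attribute [irreducible] mixDirac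

theorem measurable_mixDirac_right (x : X) :
    Measurable fun q : ProbabilityMeasure X × ℝ => mixDirac q.2 x q.1 :=
  measurable_mixDirac.comp ((measurable_const.prodMk measurable_fst).prodMk measurable_snd)

/-- The law of `b δ_x + (1 - b) ν` for independent `ν ∼ D` and `b ∼ Beta(1, c)`. -/
def stickLaw (c : ℝ) (x : X) (D : Measure (ProbabilityMeasure X)) :
    Measure (ProbabilityMeasure X) :=
  (D.prod (betaLaw c)).map fun q => mixDirac q.2 x q.1

theorem real_add_dirac_fiber {ι : Type*} [DecidableEq ι] [MeasurableSpace ι]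
    [MeasurableSingletonClass ι] {c : X → ι} (hc : Measurable c) (α : Measure X)
    [IsFiniteMeasure α] (x : X) :
    (fun i => (α + Measure.dirac x).real (c ⁻¹' {i})) =
      (fun i => α.real (c ⁻¹' {i})) + Pi.single (c x) 1 := by
  ext i
  have hi : MeasurableSet (c ⁻¹' {i}) := hc (measurableSet_singleton i)
  rw [measureReal_add_apply, Pi.add_apply]
  congr 1
  rw [measureReal_def, Measure.dirac_apply' _ hi]
  by_cases h : c x = i
  · subst h; simp
  · rw [indicator_of_notMem (by simpa using h), Pi.single_eq_of_ne (Ne.symm h)]; simp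

end DirichletProcess

/-! ### Posterior laws after one observation. -/

section DirichletProcess

variable {X : Type*} [MeasurableSpace X]

/-- On the cell masses, mixing with `δ_x` is mixing with the vertex of the cell that contains `x`,
so this is stick breaking for Dirichlet vectors. It is the source of existence for all posterior
processes. -/
theorem IsDirichletLaw.stickLaw {α : Measure X} {D : Measure (ProbabilityMeasure X)}
    (h : IsDirichletLaw α D) (x : X) :
    IsDirichletLaw (α + Measure.dirac x) (stickLaw (α.real univ) x D) := by
  have := h.isProbabilityMeasure
  have := h.isFiniteMeasure
  have hpos := h.real_univ_pos
  have := isProbabilityMeasure_betaLaw hpos.le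
  refine isDirichletLaw_of_map_fiberMass fun d c hc => ?_
  have hsum : ∑ i, α.real (c ⁻¹' {i}) = α.real univ := by
    simpa using sum_measureReal_fiber hc α Finset.univ
  have hd := isProbabilityMeasure_dirichletDistribution
    (a := fun i => α.real (c ⁻¹' {i})) fun i => measureReal_nonneg
  have hmd := measurable_mixDirac_right x
  rw [real_add_dirac_fiber hc, ← dirichletDistribution_prod_betaLaw_map
    (fun i => measureReal_nonneg) (by rw [hsum]; exact hpos), hsum, ← h.map_fiberMass hc,
    NDP.stickLaw, Measure.map_map (by fun_prop) hmd,
    ← Measure.map_id (μ := betaLaw (α.real univ)),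
    Measure.map_prod_map _ _ (by fun_prop) measurable_id, Measure.map_map (by fun_prop)
    (by fun_prop), Measure.map_id]
  refine Measure.map_congr ?_
  filter_upwards [Measure.quasiMeasurePreserving_snd.ae (betaLaw_mem_Icc hpos.le)] with q hq
  ext i
  simp only [Function.comp_apply, fiberMass,
    mixDirac_real hq x q.1 (hc (measurableSet_singleton i)), Pi.add_apply, Pi.smul_apply,
    smul_eq_mul]
  congr 2
  by_cases hi : c x = i
  · subst hi; simp
  · rw [indicator_of_notMem (by simpa using hi), Pi.single_eq_of_ne (Ne.symm hi)]

theorem IsDirichletLaw.add_dirac {α : Measure X}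
    (h : IsDirichletLaw α (dirichletLaw α)) (x : X) :
    IsDirichletLaw (α + Measure.dirac x) (dirichletLaw (α + Measure.dirac x)) := by
  rw [(h.stickLaw x).dirichletLaw_eq]
  exact h.stickLaw x

theorem IsDirichletLaw.lintegral_add_dirac {α : Measure X}
    (h : IsDirichletLaw α (dirichletLaw α)) (x : X) {f : ProbabilityMeasure X → ℝ≥0∞}
    (hf : Measurable f) :
    ∫⁻ ν, f ν ∂(dirichletLaw (α + Measure.dirac x)) =
      ∫⁻ ν, ∫⁻ b, f (mixDirac b x ν) ∂(betaLaw (α.real univ)) ∂(dirichletLaw α) := by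
  have := isProbabilityMeasure_betaLaw h.real_univ_pos.le
  have hmd := measurable_mixDirac_right x
  rw [(h.stickLaw x).dirichletLaw_eq, NDP.stickLaw, lintegral_map hf hmd,
    lintegral_prod (fun q : ProbabilityMeasure X × ℝ => f (mixDirac q.2 x q.1))
      (hf.comp hmd).aemeasurable]

/-- Evaluation of a random probability measure, as a kernel. -/
def coeKernel (X : Type*) [MeasurableSpace X] : Kernel (ProbabilityMeasure X) X :=
  ⟨fun ν => ν, measurable_subtype_coe⟩

instance : IsMarkovKernel (coeKernel X) := ⟨fun ν => inferInstanceAs (IsProbabilityMeasure (ν : Measure X))⟩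

/-- The posterior laws `x ↦ 𝒟(α + δ_x)`, as a kernel. -/
theorem IsDirichletLaw.measurable_dirichletLaw_add_dirac {α : Measure X}
    (h : IsDirichletLaw α (dirichletLaw α)) :
    Measurable fun x => dirichletLaw (α + Measure.dirac x) := by
  have := isProbabilityMeasure_betaLaw h.real_univ_pos.le
  have := h.isProbabilityMeasure
  refine Measure.measurable_of_measurable_coe _ fun s hs => ?_
  -- The choice that defines `dirichletLaw` shows no regularity in `x`. In the stick formula `x`
  -- enters only through the jointly measurable `mixDirac`.
  have h1 : ∀ x, dirichletLaw (α + Measure.dirac x) s =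
      ∫⁻ ν, ∫⁻ b, s.indicator 1 (mixDirac b x ν) ∂(betaLaw (α.real univ)) ∂(dirichletLaw α) := by
    intro x
    rw [← h.lintegral_add_dirac x (measurable_one.indicator hs), lintegral_indicator_one hs]
  simp_rw [h1]
  have h2 : Measurable fun q : (X × ProbabilityMeasure X) × ℝ =>
      s.indicator (1 : ProbabilityMeasure X → ℝ≥0∞) (mixDirac q.2 q.1.1 q.1.2) :=
    (measurable_one.indicator hs).comp measurable_mixDirac
  exact h2.lintegral_prod_right'.lintegral_prod_right'

/-- Bayes' formula for one observation, which is size biasing: a draw from `ν` that falls in cell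
`i` weights the vector of cell masses by its `i`-th coordinate, which raises the `i`-th parameter by
one, exactly as adding `δ_x` to `α` does. -/
theorem IsDirichletLaw.lintegral_lintegral {α : Measure X}
    (h : IsDirichletLaw α (dirichletLaw α)) {F : X × ProbabilityMeasure X → ℝ≥0∞}
    (hF : Measurable F) :
    ∫⁻ ν, ∫⁻ x, F (x, ν) ∂(ν : Measure X) ∂(dirichletLaw α) =
      (α univ)⁻¹ * ∫⁻ x, ∫⁻ ν, F (x, ν) ∂(dirichletLaw (α + Measure.dirac x)) ∂α := by
  have := h.isProbabilityMeasure
  have := h.isFiniteMeasure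
  have hα : α univ ≠ 0 := fun h0 => by
    have := h.real_univ_pos
    simp [measureReal_def, h0] at this
  have hαt : α univ ≠ ∞ := measure_ne_top _ _
  let K : Kernel X (ProbabilityMeasure X) :=
    ⟨fun x => dirichletLaw (α + Measure.dirac x), h.measurable_dirichletLaw_add_dirac⟩
  have hK : IsMarkovKernel K := ⟨fun x => (h.add_dirac x).isProbabilityMeasure⟩
  set m₁ : Measure (X × ProbabilityMeasure X) :=
    ((dirichletLaw α) ⊗ₘ (coeKernel X)).map Prod.swap with hm₁
  set m₂ : Measure (X × ProbabilityMeasure X) := (α univ)⁻¹ • (α ⊗ₘ K) with hm₂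
  have hfin : IsFiniteMeasure m₂ := Measure.smul_finite _ (ENNReal.inv_ne_top.2 hα)
  have h1 : ∀ {G : X × ProbabilityMeasure X → ℝ≥0∞}, Measurable G →
      ∫⁻ q, G q ∂m₁ = ∫⁻ ν, ∫⁻ x, G (x, ν) ∂(ν : Measure X) ∂(dirichletLaw α) := by
    intro G hG
    rw [hm₁, lintegral_map hG measurable_swap, Measure.lintegral_compProd (by fun_prop)]
    rfl
  have h2 : ∀ {G : X × ProbabilityMeasure X → ℝ≥0∞}, Measurable G →
      ∫⁻ q, G q ∂m₂ =
        (α univ)⁻¹ * ∫⁻ x, ∫⁻ ν, G (x, ν) ∂(dirichletLaw (α + Measure.dirac x)) ∂α := by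
    intro G hG
    rw [hm₂, lintegral_smul_measure, Measure.lintegral_compProd hG]
    rfl
  suffices hm : m₁ = m₂ by rw [← h1 hF, ← h2 hF, hm]
  refine Measure.ext_prod fun {C t} hC ht => ?_
  have hres : ∀ (m : Measure (X × ProbabilityMeasure X)) {u : Set (ProbabilityMeasure X)},
      MeasurableSet u → (m.restrict (C ×ˢ univ)).map Prod.snd u = m (C ×ˢ u) := by
    intro m u hu
    rw [Measure.map_apply measurable_snd hu, Measure.restrict_apply (measurable_snd hu)]
    congr 1
    ext q
    simp [and_comm]
  rw [← hres _ ht, ← hres _ ht]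
  congr 1
  -- For fixed `C` both sides are finite measures in `ν`. Only partitions for which `C` is a union
  -- of cells are needed, so `x ∈ C` becomes `c x ∈ I`.
  refine ext_of_map_fiberMass hC fun d c hc I hI => ?_
  ext H hH
  have hcH := measurable_fiberMass hc hH
  rw [Measure.map_apply (by fun_prop) hH, Measure.map_apply (by fun_prop) hH, hres _ hcH,
    hres _ hcH]
  set a : Fin (d + 1) → ℝ := fun i => α.real (c ⁻¹' {i}) with ha
  have hsum : ∑ i, a i = α.real univ := by
    simpa using sum_measureReal_fiber hc α Finset.univ
  have hA : 0 < ∑ i, a i := hsum ▸ h.real_univ_pos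
  have hai : ∀ i, ENNReal.ofReal (a i) = α (c ⁻¹' {i}) := fun i => by simp [ha]
  have hAu : ENNReal.ofReal (∑ i, a i) = α univ := by rw [hsum]; simp
  have e1 : m₁ (C ×ˢ (fiberMass c ⁻¹' H)) = (α univ)⁻¹ * ∑ i ∈ I,
      α (c ⁻¹' {i}) * dirichletDistribution (a + Pi.single i 1) H := by
    rw [← lintegral_indicator_one (hC.prod hcH), h1 (measurable_one.indicator (hC.prod hcH))]
    have e2 : ∀ ν : ProbabilityMeasure X, ∫⁻ x, (C ×ˢ (fiberMass c ⁻¹' H)).indicator 1 (x, ν)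
        ∂(ν : Measure X) = (fun p => ∑ i ∈ I, ENNReal.ofReal (p i) * H.indicator 1 p)
          (fiberMass c ν) := by
      intro ν
      by_cases hν : fiberMass c ν ∈ H
      · have : (fun x => (C ×ˢ (fiberMass c ⁻¹' H)).indicator (1 : X × ProbabilityMeasure X → ℝ≥0∞) (x, ν)) =
            C.indicator 1 := by
          ext x
          by_cases hx : x ∈ C <;> simp [hx, hν]
        rw [this, lintegral_indicator_one hC]
        simp only [indicator_of_mem hν, Pi.one_apply, mul_one]
        simp only [fiberMass]
        rw [← ENNReal.ofReal_sum_of_nonneg fun i _ => measureReal_nonneg,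
          sum_measureReal_fiber hc, ← hI]
        simp
      · have : (fun x => (C ×ˢ (fiberMass c ⁻¹' H)).indicator (1 : X × ProbabilityMeasure X → ℝ≥0∞) (x, ν)) = 0 := by
          ext x
          simp [hν]
        rw [this, Pi.zero_def, lintegral_zero]
        simp [hν]
    simp_rw [e2]
    have hHi : Measurable (H.indicator (1 : (Fin (d + 1) → ℝ) → ℝ≥0∞)) :=
      measurable_one.indicator hH
    rw [← lintegral_map (g := fiberMass c)
      (f := fun p => ∑ i ∈ I, ENNReal.ofReal (p i) * H.indicator 1 p) (by fun_prop)
      (by fun_prop), h.map_fiberMass hc,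
      lintegral_finsetSum _ fun i _ => by fun_prop, Finset.mul_sum]
    refine Finset.sum_congr rfl fun i _ => ?_
    have e3 := lintegral_apply_mul_dirichletDistribution (a := a) (fun i => measureReal_nonneg)
      hA i hHi
    rw [lintegral_indicator_one hH, hai, hAu] at e3
    rw [← e3, ← mul_assoc, ENNReal.inv_mul_cancel hα hαt, one_mul]
  rw [e1, ← lintegral_indicator_one (hC.prod hcH), h2 (measurable_one.indicator (hC.prod hcH))]
  congr 1
  set G : Fin (d + 1) → ℝ≥0∞ :=
    fun i => if i ∈ I then dirichletDistribution (a + Pi.single i 1) H else 0 with hG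
  have e4 : ∀ x, ∫⁻ ν, (C ×ˢ (fiberMass c ⁻¹' H)).indicator 1 (x, ν)
      ∂(dirichletLaw (α + Measure.dirac x)) =
      G (c x) := by
    intro x
    have hxI : x ∈ C ↔ c x ∈ I := by rw [hI]; simp
    by_cases hx : x ∈ C
    · have : (fun ν => (C ×ˢ (fiberMass c ⁻¹' H)).indicator (1 : X × ProbabilityMeasure X → ℝ≥0∞) (x, ν)) =
          (fiberMass c ⁻¹' H).indicator 1 := by
        ext ν
        by_cases hν : fiberMass c ν ∈ H <;> simp [hx, hν]
      simp only [hG, if_pos (hxI.1 hx)]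
      rw [this, lintegral_indicator_one hcH, ← Measure.map_apply (by fun_prop) hH,
        (h.add_dirac x).map_fiberMass hc, real_add_dirac_fiber hc]
    · have : (fun ν => (C ×ˢ (fiberMass c ⁻¹' H)).indicator (1 : X × ProbabilityMeasure X → ℝ≥0∞) (x, ν)) = 0 := by
        ext ν
        simp [hx]
      simp only [hG, if_neg (hxI.not.1 hx)]
      rw [this, Pi.zero_def, lintegral_zero]
  simp_rw [e4]
  rw [← lintegral_map (f := G) (measurable_of_finite _) hc, lintegral_fintype]
  simp only [hG, ite_mul, zero_mul, Finset.sum_ite_mem, Finset.univ_inter]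
  refine Finset.sum_congr rfl fun i _ => ?_
  rw [Measure.map_apply hc (measurableSet_singleton i), mul_comm]

end DirichletProcess

/-! ### Samples from a Dirichlet process -/

section Samples

variable {X : Type*}

/-- Append an entry to a tuple. -/
def append {k : ℕ} (x : Fin k → X) (z : X) : Fin (k + 1) → X := Fin.snoc (α := fun _ => X) x z

@[simp]
theorem append_castSucc {k : ℕ} (x : Fin k → X) (z : X) (i : Fin k) :
    append x z i.castSucc = x i := by
  simp [append]

@[simp]
theorem append_last {k : ℕ} (x : Fin k → X) (z : X) : append x z (Fin.last k) = z := by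
  simp [append]

theorem append_init {k : ℕ} (x : Fin (k + 1) → X) :
    append (fun i => x i.castSucc) (x (Fin.last k)) = x := by
  ext i
  refine Fin.lastCases ?_ (fun j => ?_) i <;> simp

variable [MeasurableSpace X]

@[fun_prop]
theorem measurable_append {Z : Type*} [MeasurableSpace Z] {k : ℕ} {f : Z → Fin k → X} {g : Z → X}
    (hf : Measurable f) (hg : Measurable g) : Measurable fun a => append (f a) (g a) := by
  refine measurable_pi_lambda _ fun i => ?_
  refine Fin.lastCases ?_ (fun j => ?_) i
  · simpa using hg
  · simpa using measurable_pi_iff.1 hf j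

instance isProbabilityMeasure_iidLaw (N : ℕ) (ν : ProbabilityMeasure X) :
    IsProbabilityMeasure (iidLaw N ν) := by
  unfold iidLaw; infer_instance

theorem measurable_iidLaw (N : ℕ) : Measurable (iidLaw (S := X) N) := by
  refine Measurable.measure_of_isPiSystem_of_isProbabilityMeasure
    generateFrom_pi.symm isPiSystem_pi ?_
  rintro _ ⟨t, ht, rfl⟩
  simp only [iidLaw, Measure.pi_pi]
  exact Finset.measurable_prod _ fun i _ => measurable_coe_apply (ht i (mem_univ i))

theorem lintegral_iidLaw_succ (k : ℕ) (ν : ProbabilityMeasure X) {f : (Fin (k + 1) → X) → ℝ≥0∞}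
    (hf : Measurable f) :
    ∫⁻ x, f x ∂(iidLaw (k + 1) ν) =
      ∫⁻ x, ∫⁻ z, f (append x z) ∂(ν : Measure X) ∂(iidLaw k ν) := by
  have hmp := (measurePreserving_piFinSuccAbove (fun _ : Fin (k + 1) => (ν : Measure X))
    (Fin.last k)).symm
  have h1 := hmp.lintegral_comp hf
  rw [iidLaw, ← h1, lintegral_prod_symm _ (by fun_prop)]
  refine lintegral_congr fun x => lintegral_congr fun z => ?_
  congr 1
  simp [MeasurableEquiv.piFinSuccAbove_symm_apply, Fin.insertNthEquiv, append, Fin.insertNth_last']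

/-- The law of a sample of size `N` from a random probability measure with law `D`. -/
def mixLaw (D : Measure (ProbabilityMeasure X)) (N : ℕ) : Measure (Fin N → X) :=
  D.bind (iidLaw N)

theorem lintegral_mixLaw (D : Measure (ProbabilityMeasure X)) (N : ℕ)
    {f : (Fin N → X) → ℝ≥0∞} (hf : Measurable f) :
    ∫⁻ x, f x ∂(mixLaw D N) = ∫⁻ ν, ∫⁻ x, f x ∂(iidLaw N ν) ∂D :=
  Measure.lintegral_bind (measurable_iidLaw N).aemeasurable hf.aemeasurable

/-- The parameter `α + ∑ₙ δ_{x n}` of the posterior given the sample `x`. -/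
def posteriorParam (α : Measure X) {k : ℕ} (x : Fin k → X) : Measure X :=
  α + ∑ n, Measure.dirac (x n)

theorem posteriorParam_append (α : Measure X) {k : ℕ} (x : Fin k → X) (z : X) :
    posteriorParam α (append x z) = posteriorParam α x + Measure.dirac z := by
  simp [posteriorParam, Fin.sum_univ_castSucc, add_assoc]

theorem posteriorParam_univ (α : Measure X) {k : ℕ} (x : Fin k → X) :
    posteriorParam α x univ = α univ + k := by
  simp [posteriorParam]

theorem IsDirichletLaw.posterior {α : Measure X} (h : IsDirichletLaw α (dirichletLaw α)) {k : ℕ}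
    (x : Fin k → X) :
    IsDirichletLaw (posteriorParam α x) (dirichletLaw (posteriorParam α x)) := by
  induction k with
  | zero => simpa [posteriorParam] using h
  | succ k ih =>
    rw [← append_init x, posteriorParam_append]
    exact (ih _).add_dirac _

theorem IsDirichletLaw.measurable_posterior {α : Measure X}
    (h : IsDirichletLaw α (dirichletLaw α)) (k : ℕ) :
    Measurable fun x : Fin k → X => dirichletLaw (posteriorParam α x) := by
  induction k with
  | zero => exact Subsingleton.measurable
  | succ k ih =>
    refine Measure.measurable_of_measurable_coe _ fun s hs => ?_
    let K : Kernel (Fin (k + 1) → X) (ProbabilityMeasure X) :=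
      ⟨fun x => dirichletLaw (posteriorParam α fun i : Fin k => x i.castSucc),
        ih.comp (by fun_prop)⟩
    have hK : IsMarkovKernel K := ⟨fun x => (h.posterior _).isProbabilityMeasure⟩
    -- The total mass depends on the sample size only, so one Beta law serves all `x`.
    have hc : ∀ x : Fin k → X, (posteriorParam α x).real univ = (α univ + k).toReal := fun x => by
      rw [measureReal_def, posteriorParam_univ]
    have := isProbabilityMeasure_betaLaw (ENNReal.toReal_nonneg (a := α univ + k))
    have h1 : ∀ x : Fin (k + 1) → X, dirichletLaw (posteriorParam α x) s =
        ∫⁻ ν, ∫⁻ b, s.indicator 1 (mixDirac b (x (Fin.last k)) ν)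
          ∂(betaLaw (α univ + k).toReal) ∂(K x) := by
      intro x
      rw [← lintegral_indicator_one hs]
      conv_lhs => rw [← append_init x, posteriorParam_append]
      rw [(h.posterior _).lintegral_add_dirac _ (measurable_one.indicator hs), hc]
      rfl
    simp_rw [h1]
    have h2 : Measurable fun q : ((Fin (k + 1) → X) × ProbabilityMeasure X) × ℝ =>
        s.indicator (1 : ProbabilityMeasure X → ℝ≥0∞)
          (mixDirac q.2 (q.1.1 (Fin.last k)) q.1.2) :=
      (measurable_one.indicator hs).comp (measurable_mixDirac.comp (by fun_prop :
        Measurable fun q : ((Fin (k + 1) → X) × ProbabilityMeasure X) × ℝ =>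
          ((q.1.1 (Fin.last k), q.1.2), q.2)))
    exact h2.lintegral_prod_right'.lintegral_kernel_prod_right'

theorem measurable_lintegral_coe {Z : Type*} [MeasurableSpace Z] {g : Z → ProbabilityMeasure X}
    (hg : Measurable g) {f : Z × X → ℝ≥0∞} (hf : Measurable f) :
    Measurable fun a => ∫⁻ z, f (a, z) ∂(g a : Measure X) :=
  Measurable.lintegral_kernel_prod_right' (κ := (coeKernel X).comap g hg) hf

theorem IsDirichletLaw.measurable_lintegral_posterior {α : Measure X}
    (h : IsDirichletLaw α (dirichletLaw α)) {k : ℕ}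
    {F : (Fin k → X) × ProbabilityMeasure X → ℝ≥0∞} (hF : Measurable F) :
    Measurable fun x => ∫⁻ ν, F (x, ν) ∂(dirichletLaw (posteriorParam α x)) := by
  let K : Kernel (Fin k → X) (ProbabilityMeasure X) :=
    ⟨fun x => dirichletLaw (posteriorParam α x), h.measurable_posterior k⟩
  have hK : IsMarkovKernel K := ⟨fun x => (h.posterior _).isProbabilityMeasure⟩
  exact Measurable.lintegral_kernel_prod_right' (κ := K) hF

/-- Bayes' formula for samples and the urn scheme are proved by one induction. With Bayes' formula
at size `k` as the hypothesis `hk`, the one-observation formula is applied to the posterior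
`𝒟(posteriorParam α x)`. -/
theorem IsDirichletLaw.lintegral_succ_aux {α : Measure X}
    (h : IsDirichletLaw α (dirichletLaw α)) {k : ℕ}
    (hk : ∀ F : (Fin k → X) × ProbabilityMeasure X → ℝ≥0∞, Measurable F →
      ∫⁻ ν, ∫⁻ x, F (x, ν) ∂(iidLaw k ν) ∂(dirichletLaw α) =
        ∫⁻ x, ∫⁻ ν, F (x, ν) ∂(dirichletLaw (posteriorParam α x)) ∂(mixLaw (dirichletLaw α) k))
    {F : (Fin (k + 1) → X) × ProbabilityMeasure X → ℝ≥0∞} (hF : Measurable F) :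
    ∫⁻ ν, ∫⁻ x, F (x, ν) ∂(iidLaw (k + 1) ν) ∂(dirichletLaw α) =
      ∫⁻ x, (α univ + k)⁻¹ * ∫⁻ z, ∫⁻ ν, F (append x z, ν)
        ∂(dirichletLaw (posteriorParam α (append x z))) ∂(posteriorParam α x)
        ∂(mixLaw (dirichletLaw α) k) := by
  have h1 : Measurable fun q : (Fin k → X) × ProbabilityMeasure X =>
      ∫⁻ z, F (append q.1 z, q.2) ∂(q.2 : Measure X) :=
    measurable_lintegral_coe measurable_snd (by fun_prop : Measurable
      fun q : ((Fin k → X) × ProbabilityMeasure X) × X => F (append q.1.1 q.2, q.1.2))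
  calc ∫⁻ ν, ∫⁻ x, F (x, ν) ∂(iidLaw (k + 1) ν) ∂(dirichletLaw α)
      = ∫⁻ ν, ∫⁻ x, ∫⁻ z, F (append x z, ν) ∂(ν : Measure X) ∂(iidLaw k ν) ∂(dirichletLaw α) :=
        lintegral_congr fun ν => lintegral_iidLaw_succ k ν (by fun_prop)
    _ = _ := hk _ h1
    _ = _ := by
        refine lintegral_congr fun x => ?_
        rw [(h.posterior x).lintegral_lintegral (F := fun q => F (append x q.1, q.2))
          (by fun_prop), posteriorParam_univ]
        simp_rw [posteriorParam_append]

/-- This is `lintegral_succ_aux` for integrands that do not involve `ν`. Comparing the two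
identities gives Bayes' formula at size `k + 1`. -/
theorem IsDirichletLaw.lintegral_mixLaw_succ_aux {α : Measure X}
    (h : IsDirichletLaw α (dirichletLaw α)) {k : ℕ}
    (hk : ∀ F : (Fin k → X) × ProbabilityMeasure X → ℝ≥0∞, Measurable F →
      ∫⁻ ν, ∫⁻ x, F (x, ν) ∂(iidLaw k ν) ∂(dirichletLaw α) =
        ∫⁻ x, ∫⁻ ν, F (x, ν) ∂(dirichletLaw (posteriorParam α x)) ∂(mixLaw (dirichletLaw α) k))
    {f : (Fin (k + 1) → X) → ℝ≥0∞} (hf : Measurable f) :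
    ∫⁻ x, f x ∂(mixLaw (dirichletLaw α) (k + 1)) =
      ∫⁻ x, (α univ + k)⁻¹ * ∫⁻ z, f (append x z) ∂(posteriorParam α x)
        ∂(mixLaw (dirichletLaw α) k) := by
  rw [lintegral_mixLaw _ _ hf,
    h.lintegral_succ_aux hk (F := fun q => f q.1) (hf.comp measurable_fst)]
  have hp : ∀ x : Fin (k + 1) → X, IsProbabilityMeasure (dirichletLaw (posteriorParam α x)) :=
    fun x => (h.posterior x).isProbabilityMeasure
  simp

/-- Bayes' formula: given a sample `x` from `ν ∼ 𝒟(α)`, the law of `ν` is `𝒟(α + ∑ₙ δ_{x n})`. -/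
theorem IsDirichletLaw.lintegral_posterior {α : Measure X}
    (h : IsDirichletLaw α (dirichletLaw α)) {k : ℕ}
    {F : (Fin k → X) × ProbabilityMeasure X → ℝ≥0∞} (hF : Measurable F) :
    ∫⁻ ν, ∫⁻ x, F (x, ν) ∂(iidLaw k ν) ∂(dirichletLaw α) =
      ∫⁻ x, ∫⁻ ν, F (x, ν) ∂(dirichletLaw (posteriorParam α x))
        ∂(mixLaw (dirichletLaw α) k) := by
  induction k with
  | zero =>
    rw [lintegral_mixLaw _ _ (h.measurable_lintegral_posterior hF)]
    have := h.isProbabilityMeasure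
    simp [iidLaw, posteriorParam, lintegral_unique]
  | succ k ih =>
    rw [h.lintegral_succ_aux (fun F hF => ih hF) hF, h.lintegral_mixLaw_succ_aux
      (fun F hF => ih hF) (h.measurable_lintegral_posterior hF)]

/-- The Pólya urn scheme: the next entry of a sample from a Dirichlet process. -/
theorem IsDirichletLaw.lintegral_mixLaw_succ {α : Measure X}
    (h : IsDirichletLaw α (dirichletLaw α)) {k : ℕ} {f : (Fin (k + 1) → X) → ℝ≥0∞}
    (hf : Measurable f) :
    ∫⁻ x, f x ∂(mixLaw (dirichletLaw α) (k + 1)) =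
      ∫⁻ x, (α univ + k)⁻¹ * ∫⁻ z, f (append x z) ∂(posteriorParam α x)
        ∂(mixLaw (dirichletLaw α) k) :=
  h.lintegral_mixLaw_succ_aux (fun _ hF => h.lintegral_posterior hF) hf

/-- The mean of a Dirichlet process. -/
theorem IsDirichletLaw.lintegral_mean {α : Measure X}
    (h : IsDirichletLaw α (dirichletLaw α)) {f : X → ℝ≥0∞} (hf : Measurable f) :
    ∫⁻ ν, ∫⁻ x, f x ∂(ν : Measure X) ∂(dirichletLaw α) = (α univ)⁻¹ * ∫⁻ x, f x ∂α := by
  rw [h.lintegral_lintegral (F := fun q => f q.1) (hf.comp measurable_fst)]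
  have hp : ∀ x, IsProbabilityMeasure (dirichletLaw (α + Measure.dirac x)) :=
    fun x => (h.add_dirac x).isProbabilityMeasure
  simp

end Samples

/-! ### Weak convergence -/

section Weak

/-- The finite unions of members of a countable basis. -/
def basisUnions (X : Type*) [TopologicalSpace X] [SecondCountableTopology X] : Set (Set X) :=
  sUnion '' {T : Set (Set X) | T.Finite ∧ T ⊆ TopologicalSpace.countableBasis X}

variable {X : Type*} [TopologicalSpace X] [SecondCountableTopology X]

theorem countable_basisUnions : (basisUnions X).Countable :=
  (countable_ofPred_finite_subset (TopologicalSpace.countable_countableBasis X)).image _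

theorem isOpen_of_mem_basisUnions {U : Set X} (hU : U ∈ basisUnions X) : IsOpen U := by
  obtain ⟨T, ⟨_, hT⟩, rfl⟩ := hU
  exact isOpen_sUnion fun t ht => TopologicalSpace.isOpen_of_mem_countableBasis (hT ht)

variable [MeasurableSpace X]

/-- An open set is a union of basic sets, and by continuity of the measure finitely many of them
nearly exhaust its mass. -/
theorem exists_mem_basisUnions_lt (m : Measure X) [IsProbabilityMeasure m] {G : Set X}
    (hG : IsOpen G) {r : ℝ≥0∞} (hr : r < m G) : ∃ U ∈ basisUnions X, U ⊆ G ∧ r < m U := by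
  lift r to ℝ≥0 using hr.ne_top
  have hb := TopologicalSpace.isBasis_countableBasis X
  let m' : ProbabilityMeasure X := ⟨m, inferInstance⟩
  have hm : ∀ s, ((m' s : ℝ≥0) : ℝ≥0∞) = m s := fun s => by
    rw [ProbabilityMeasure.ennreal_coeFn_eq_coeFn_toMeasure]; rfl
  obtain ⟨T, hT, hlt, hsub⟩ := ProbabilityMeasure.exists_lt_measure_biUnion_of_isOpen
    (S := TopologicalSpace.countableBasis X) m' (fun u hu x hx => by
      obtain ⟨v, hv, hxv, hvu⟩ := hb.exists_subset_of_mem_open hx hu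
      exact ⟨v, hv, (hb.isOpen hv).mem_nhds hxv, hvu⟩) hG (r := r) (by
        rw [← ENNReal.coe_lt_coe, hm]; exact hr)
  refine ⟨⋃ t ∈ T, t, ⟨T, ⟨T.finite_toSet, fun t ht => hT t ht⟩, ?_⟩, hsub, ?_⟩
  · rw [sUnion_eq_biUnion]; rfl
  · rw [← hm]; exact_mod_cast hlt

theorem le_liminf_of_tendsto_basisUnions {Q : ℕ → Measure X} {Q' : Measure X}
    [IsProbabilityMeasure Q']
    (h : ∀ U ∈ basisUnions X, Tendsto (fun n => Q n U) atTop (𝓝 (Q' U))) {G : Set X}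
    (hG : IsOpen G) : Q' G ≤ liminf (fun n => Q n G) atTop := by
  refine le_of_forall_lt fun r hr => ?_
  obtain ⟨U, hU, hUG, hrU⟩ := exists_mem_basisUnions_lt Q' hG hr
  rw [← (h U hU).liminf_eq] at hrU
  exact hrU.trans_le (liminf_le_liminf (Eventually.of_forall fun n => measure_mono hUG))

/-- The continuous mapping theorem, for weak convergence checked on finite unions of basic open
sets. -/
theorem weaklyConverges_map {E : Type*} [TopologicalSpace E] [MeasurableSpace E]
    [OpensMeasurableSpace E] [HasOuterApproxClosed E]
    {Q : ℕ → Measure X} {Q' : Measure X} (hQ : ∀ n, IsProbabilityMeasure (Q (n + 1)))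
    [OpensMeasurableSpace X]
    [IsProbabilityMeasure Q']
    (h : ∀ U ∈ basisUnions X, Tendsto (fun n => Q n U) atTop (𝓝 (Q' U)))
    {Φ : X → E} (hΦ : Measurable Φ) (hc : ∀ᵐ x ∂Q', ContinuousAt Φ x) :
    WeaklyConverges (fun n => (Q n).map Φ) (Q'.map Φ) := by
  -- The shift by one is needed because an empirical law at index `0` is an empty sum, hence not a
  -- probability measure.
  let R : ℕ → ProbabilityMeasure E := fun n =>
    ⟨(Q (n + 1)).map Φ, Measure.isProbabilityMeasure_map hΦ.aemeasurable⟩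
  let R' : ProbabilityMeasure E := ⟨Q'.map Φ, Measure.isProbabilityMeasure_map hΦ.aemeasurable⟩
  have hR : Tendsto R atTop (𝓝 R') := by
    refine tendsto_of_forall_isOpen_le_liminf' fun G hG => ?_
    change Q'.map Φ G ≤ liminf (fun n => (Q (n + 1)).map Φ G) atTop
    simp_rw [Measure.map_apply hΦ hG.measurableSet]
    -- A continuity point of `Φ` in the preimage of an open set is interior to that preimage, so
    -- passing to the interior loses only a null set.
    calc Q' (Φ ⁻¹' G) ≤ Q' (interior (Φ ⁻¹' G)) := by
          refine measure_mono_ae ?_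
          filter_upwards [hc] with x hx hxG
          exact mem_interior_iff_mem_nhds.2 (hx (hG.mem_nhds hxG))
      _ ≤ liminf (fun n => Q (n + 1) (interior (Φ ⁻¹' G))) atTop :=
          le_liminf_of_tendsto_basisUnions (Q := fun n => Q (n + 1))
            (fun U hU => (tendsto_add_atTop_iff_nat 1).2 (h U hU)) isOpen_interior
      _ ≤ _ := liminf_le_liminf (Eventually.of_forall fun n => measure_mono interior_subset)
  intro f
  rw [← tendsto_add_atTop_iff_nat 1]
  exact (ProbabilityMeasure.tendsto_iff_forall_integral_tendsto.1 hR) f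

end Weak

/-! ### Countable base and measurability of open sets for the weak topology. -/

section ProbabilityMeasure

variable (S : Type*) [TopologicalSpace S] [SecondCountableTopology S] [MeasurableSpace S]

/-- The sets `{ν | q < ν U}`, which generate the topology of weak convergence. -/
def weakSubbasis : Set (Set (ProbabilityMeasure S)) :=
  image2 (fun (U : Set S) (q : ℝ≥0∞) => {ν : ProbabilityMeasure S | q < (ν : Measure S) U})
    (basisUnions S) (range fun q : ℚ => ENNReal.ofReal q)

theorem countable_weakSubbasis : (weakSubbasis S).Countable :=
  countable_basisUnions.image2 (countable_range _) _

variable [OpensMeasurableSpace S] [HasOuterApproxClosed S]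

/-- Both halves are the portmanteau theorem: `ν ↦ ν U` is lower semicontinuous for open `U`, and
conversely lower bounds on open sets force weak convergence. The converse is used along a
neighbourhood filter of the generated topology, which is countably generated because the subbasis is
countable. -/
theorem eq_generateFrom_weakSubbasis :
    (inferInstance : TopologicalSpace (ProbabilityMeasure S)) =
      TopologicalSpace.generateFrom (weakSubbasis S) := by
  refine le_antisymm (le_generateFrom ?_) ?_
  · rintro _ ⟨U, hU, q, -, rfl⟩
    refine isOpen_iff_mem_nhds.2 fun ν hν => ?_
    have h1 := ProbabilityMeasure.le_liminf_measure_open_of_tendsto (L := 𝓝 ν) (μ := ν)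
      (μs := id) tendsto_id (isOpen_of_mem_basisUnions hU)
    exact eventually_lt_of_lt_liminf (lt_of_lt_of_le hν h1)
  · have : @SecondCountableTopology (ProbabilityMeasure S)
        (TopologicalSpace.generateFrom (weakSubbasis S)) :=
      @SecondCountableTopology.mk _ (TopologicalSpace.generateFrom _)
        ⟨_, countable_weakSubbasis S, rfl⟩
    rw [← continuous_id_iff_le]
    refine (@continuous_iff_continuousAt _ _ (TopologicalSpace.generateFrom (weakSubbasis S)) _
      id).2 fun ν => ?_
    have hfc : (@nhds _ (TopologicalSpace.generateFrom (weakSubbasis S)) ν).IsCountablyGenerated :=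
      @FirstCountableTopology.nhds_generated_countable _ _ inferInstance ν
    refine tendsto_of_forall_isOpen_le_liminf' fun G hG => ?_
    refine le_of_forall_lt fun r hr => ?_
    obtain ⟨U, hU, hUG, hrU⟩ := exists_mem_basisUnions_lt (ν : Measure S) hG hr
    obtain ⟨q, _, hrq, hqU⟩ := ENNReal.lt_iff_exists_rat_btwn.1 hrU
    refine lt_of_lt_of_le hrq (le_liminf_of_le (by isBoundedDefault) ?_)
    have hmem : {ν : ProbabilityMeasure S | ENNReal.ofReal q < (ν : Measure S) U} ∈
        @nhds _ (TopologicalSpace.generateFrom (weakSubbasis S)) ν := by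
      rw [TopologicalSpace.nhds_generateFrom]
      exact mem_iInf_of_mem _ (mem_iInf_of_mem
        ⟨by simpa [ENNReal.ofReal] using hqU, ⟨U, hU, _, ⟨q, rfl⟩, rfl⟩⟩ (mem_principal_self _))
    filter_upwards [hmem] with ν' hν'
    exact hν'.le.trans (measure_mono hUG)

theorem secondCountableTopology_probabilityMeasure :
    SecondCountableTopology (ProbabilityMeasure S) :=
  ⟨⟨_, countable_weakSubbasis S, eq_generateFrom_weakSubbasis S⟩⟩

/-- The σ-algebra is that of the evaluations. With a countable subbasis the Borel sets are generated
by the sets `{ν | q < ν U}`, which evaluations measure. -/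
theorem opensMeasurableSpace_probabilityMeasure :
    OpensMeasurableSpace (ProbabilityMeasure S) := by
  have := secondCountableTopology_probabilityMeasure S
  refine ⟨?_⟩
  rw [borel_eq_generateFrom_of_subbasis (eq_generateFrom_weakSubbasis S)]
  refine MeasurableSpace.generateFrom_le ?_
  rintro _ ⟨U, hU, q, -, rfl⟩
  exact measurableSet_lt measurable_const
    (measurable_coe_apply (isOpen_of_mem_basisUnions hU).measurableSet)

end ProbabilityMeasure

/-! ### The law of a weighted simulation -/

section Simulation

variable {S : Type*} [MeasurableSpace S] {κ ε : ℝ≥0} {ϱ : ProbabilityMeasure S}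

theorem oldWeight_le_one {N : ℕ} (A : Set (Fin N → S)) (ν : ProbabilityMeasure S) :
    oldWeight A ν ≤ 1 := prob_le_one

theorem sampleLaw_le_one {N : ℕ} (A : Set (Fin N → S)) : sampleLaw ε ϱ N A ≤ 1 := by
  have hD := dirichletLaw_univ_le ((ε : ℝ≥0∞) • (ϱ : Measure S))
  refine (measure_mono (subset_univ A)).trans ?_
  rw [sampleLaw, Measure.bind_apply MeasurableSet.univ (measurable_iidLaw N).aemeasurable]
  simpa using hD

/-- Apply Bayes' formula for samples to `1_A(x) f(ν)`; the normalisation of the conditioning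
cancels. The row posterior is thus the prior with density proportional to `ν^N(A)`. -/
theorem lintegral_rowPosterior
    (h : IsDirichletLaw ((ε : ℝ≥0∞) • (ϱ : Measure S))
      (dirichletLaw ((ε : ℝ≥0∞) • (ϱ : Measure S)))) {N : ℕ} {A : Set (Fin N → S)}
    (hA : MeasurableSet A) (hA0 : sampleLaw ε ϱ N A ≠ 0) {f : ProbabilityMeasure S → ℝ≥0∞}
    (hf : Measurable f) :
    sampleLaw ε ϱ N A * ∫⁻ ν, f ν ∂(rowPosterior ε ϱ A) =
      ∫⁻ ν, oldWeight A ν * f ν ∂(dirichletLaw ((ε : ℝ≥0∞) • (ϱ : Measure S))) := by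
  have := h.isProbabilityMeasure
  have hsl : sampleLaw ε ϱ N = mixLaw (dirichletLaw ((ε : ℝ≥0∞) • (ϱ : Measure S))) N := rfl
  have hfin : sampleLaw ε ϱ N A ≠ ∞ := ne_top_of_le_ne_top ENNReal.one_ne_top (sampleLaw_le_one A)
  have h1 : ∫⁻ ν, f ν ∂(rowPosterior ε ϱ A) = ∫⁻ x, ∫⁻ ν, f ν
      ∂(dirichletLaw (posteriorParam ((ε : ℝ≥0∞) • (ϱ : Measure S)) x))
      ∂(cond (sampleLaw ε ϱ N) A) :=
    Measure.lintegral_bind (h.measurable_posterior N).aemeasurable hf.aemeasurable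
  rw [h1, ProbabilityTheory.cond, lintegral_smul_measure, smul_eq_mul, ← mul_assoc,
    ENNReal.mul_inv_cancel hA0 hfin, one_mul, ← lintegral_indicator hA]
  have h2 := h.lintegral_posterior (k := N) (F := fun q => A.indicator 1 q.1 * f q.2)
    (((measurable_one.indicator hA).comp measurable_fst).mul (hf.comp measurable_snd))
  rw [← hsl] at h2
  calc _ = ∫⁻ x, ∫⁻ ν, A.indicator 1 x * f ν
        ∂(dirichletLaw (posteriorParam ((ε : ℝ≥0∞) • (ϱ : Measure S)) x)) ∂(sampleLaw ε ϱ N) := by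
        refine lintegral_congr fun x => ?_
        by_cases hx : x ∈ A <;> simp [hx]
    _ = _ := h2.symm
    _ = _ := by
        refine lintegral_congr fun ν => ?_
        dsimp only
        rw [lintegral_mul_const _ (measurable_one.indicator hA), lintegral_indicator_one hA]
        rfl

theorem rowWeightSum_ne_zero (hκ : 0 < κ) {N : ℕ} {A : Set (Fin N → S)}
    (hA0 : sampleLaw ε ϱ N A ≠ 0) {ι : Type*} [Fintype ι] (ν : ι → ProbabilityMeasure S) :
    rowWeightSum κ ε ϱ A ν ≠ 0 := by
  have : newWeight κ ε ϱ A ≠ 0 := mul_ne_zero (by exact_mod_cast hκ.ne') hA0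
  simp [rowWeightSum, this]

theorem rowWeightSum_le {N : ℕ} (A : Set (Fin N → S)) {ι : Type*} [Fintype ι]
    (ν : ι → ProbabilityMeasure S) :
    rowWeightSum κ ε ϱ A ν ≤ κ + Fintype.card ι := by
  unfold rowWeightSum newWeight
  gcongr
  · exact mul_le_of_le_one_right' (sampleLaw_le_one A)
  · exact (Finset.sum_le_sum fun i _ => oldWeight_le_one A (ν i)).trans (by simp)

theorem rowWeightSum_ne_top {N : ℕ} (A : Set (Fin N → S)) {ι : Type*} [Fintype ι]
    (ν : ι → ProbabilityMeasure S) : rowWeightSum κ ε ϱ A ν ≠ ∞ :=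
  ne_top_of_le_ne_top (by simp) (rowWeightSum_le A ν)

theorem measurable_rowWeightSum {N : ℕ} {A : Set (Fin N → S)} (hA : MeasurableSet A)
    (ι : Type*) [Fintype ι] :
    Measurable fun ν : ι → ProbabilityMeasure S => rowWeightSum κ ε ϱ A ν := by
  have h := measurable_oldWeight hA
  unfold rowWeightSum
  fun_prop

theorem rowWeightSum_comp_equiv {N : ℕ} (A : Set (Fin N → S)) {ι ι' : Type*} [Fintype ι]
    [Fintype ι'] (e : ι ≃ ι') (ν : ι' → ProbabilityMeasure S) :
    rowWeightSum κ ε ϱ A (fun i => ν (e i)) = rowWeightSum κ ε ϱ A ν := by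
  unfold rowWeightSum
  rw [e.sum_comp fun i => oldWeight A (ν i)]

/-- The reason for the weights: times its normaliser, the simulation kernel is the unnormalised urn
measure with density `oldWeight A`. For the atoms this is immediate, for the new row it is
`lintegral_rowPosterior`. -/
theorem rowWeightSum_mul_lintegral_simulationKernel (hκ : 0 < κ)
    (h : IsDirichletLaw ((ε : ℝ≥0∞) • (ϱ : Measure S))
      (dirichletLaw ((ε : ℝ≥0∞) • (ϱ : Measure S)))) {N : ℕ} {A : Set (Fin N → S)}
    (hA : MeasurableSet A) (hA0 : sampleLaw ε ϱ N A ≠ 0) {ι : Type*} [Fintype ι]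
    (ν : ι → ProbabilityMeasure S) {f : ProbabilityMeasure S → ℝ≥0∞} (hf : Measurable f) :
    rowWeightSum κ ε ϱ A ν * ∫⁻ z, f z ∂(simulationKernel κ ε ϱ A hA ι ν) =
      ∫⁻ z, oldWeight A z * f z
        ∂((κ : ℝ≥0∞) • dirichletLaw ((ε : ℝ≥0∞) • (ϱ : Measure S)) +
          ∑ i, Measure.dirac (ν i)) := by
  have hk : simulationKernel κ ε ϱ A hA ι ν = (rowWeightSum κ ε ϱ A ν)⁻¹ •
    (newWeight κ ε ϱ A • rowPosterior ε ϱ A + ∑ i, oldWeight A (ν i) • Measure.dirac (ν i)) := rfl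
  have hm : Measurable fun z => oldWeight A z * f z := (measurable_oldWeight hA).mul hf
  rw [hk, lintegral_smul_measure, smul_eq_mul, ← mul_assoc, ENNReal.mul_inv_cancel
    (rowWeightSum_ne_zero hκ hA0 ν) (rowWeightSum_ne_top A ν), one_mul, lintegral_add_measure,
    lintegral_add_measure, lintegral_smul_measure, lintegral_smul_measure,
    lintegral_finsetSum_measure, lintegral_finsetSum_measure]
  congr 1
  · rw [newWeight, smul_eq_mul, smul_eq_mul, mul_assoc, lintegral_rowPosterior h hA hA0 hf]
  · refine Finset.sum_congr rfl fun i _ => ?_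
    rw [lintegral_smul_measure, lintegral_dirac' _ hf, lintegral_dirac' _ hm, smul_eq_mul]

theorem measurable_lintegral_posteriorParam {X : Type*} [MeasurableSpace X]
    (α : Measure X) [SFinite α] {k : ℕ} {f : (Fin k → X) × X → ℝ≥0∞} (hf : Measurable f) :
    Measurable fun x => ∫⁻ z, f (x, z) ∂(posteriorParam α x) := by
  have h1 : ∀ x, ∫⁻ z, f (x, z) ∂(posteriorParam α x) = ∫⁻ z, f (x, z) ∂α + ∑ i, f (x, x i) := by
    intro x
    rw [posteriorParam, lintegral_add_measure, lintegral_finsetSum_measure]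
    congr 1
    exact Finset.sum_congr rfl fun i _ => lintegral_dirac' _ (by fun_prop)
  simp_rw [h1]
  exact hf.lintegral_prod_right'.add (Finset.measurable_sum _ fun i _ => by fun_prop)

/-- The indices below `m`, as natural numbers. -/
def finEquivIio {M : ℕ} (m : Fin M) : Fin m ≃ Iio m where
  toFun j := ⟨Fin.castLE m.2.le j, by
    rw [mem_Iio, Fin.lt_def]; exact j.2⟩
  invFun i := ⟨i.1, i.2⟩
  left_inv j := rfl
  right_inv i := rfl

/-- The weight of the first `m` steps of a simulation. -/
def partialWeight (κ ε : ℝ≥0) (ϱ : ProbabilityMeasure S) {M N : ℕ} (A : Fin M → Set (Fin N → S))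
    {m : ℕ} (hm : m ≤ M) (v : Fin m → ProbabilityMeasure S) : ℝ≥0∞ :=
  ∏ i : Fin m, ((κ : ℝ≥0∞) + (i : ℕ))⁻¹ *
    rowWeightSum κ ε ϱ (A (Fin.castLE hm i)) fun j : Fin i => v (Fin.castLE i.2.le j)

theorem totalWeight_eq_partialWeight {M N : ℕ} (A : Fin M → Set (Fin N → S))
    (v : Fin M → ProbabilityMeasure S) :
    totalWeight κ ε ϱ A v = partialWeight κ ε ϱ A le_rfl v := by
  refine Finset.prod_congr rfl fun m _ => ?_
  congr 1
  exact (rowWeightSum_comp_equiv (A m) (finEquivIio m) fun i : Iio m => v i).symm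

theorem measurable_partialWeight {M N : ℕ} {A : Fin M → Set (Fin N → S)}
    (hA : ∀ m, MeasurableSet (A m)) {m : ℕ} (hm : m ≤ M) :
    Measurable (partialWeight κ ε ϱ A hm) := by
  refine Finset.measurable_prod _ fun i _ => Measurable.const_mul ?_ _
  exact (measurable_rowWeightSum (hA _) _).comp (by fun_prop)

theorem partialWeight_append {M N : ℕ} (A : Fin M → Set (Fin N → S)) {m : ℕ} (hm : m + 1 ≤ M)
    (v : Fin m → ProbabilityMeasure S) (z : ProbabilityMeasure S) :
    partialWeight κ ε ϱ A hm (append v z) = partialWeight κ ε ϱ A (m.le_succ.trans hm) v *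
      (((κ : ℝ≥0∞) + m)⁻¹ * rowWeightSum κ ε ϱ (A ⟨m, hm⟩) v) := by
  rw [partialWeight, Fin.prod_univ_castSucc]
  congr 1
  · refine Finset.prod_congr rfl fun i _ => ?_
    congr 2
    ext1 j
    exact append_castSucc v z (Fin.castLE i.2.le j)
  · congr 2
    ext1 j
    exact append_castSucc v z j

/-- Integrating out row `m` given the earlier ones, the factor `rowWeightSum` cancels the normaliser
of the kernel. The earlier rows are reindexed from `Iio m` to `Fin m` to suit the urn. -/
theorem IsWeightedSimulation.lintegral_step {Ω : Type*} [MeasurableSpace Ω] {P : Measure Ω}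
    [IsProbabilityMeasure P] (hκ : 0 < κ)
    (h : IsDirichletLaw ((ε : ℝ≥0∞) • (ϱ : Measure S))
      (dirichletLaw ((ε : ℝ≥0∞) • (ϱ : Measure S)))) {M N : ℕ} {A : Fin M → Set (Fin N → S)}
    {hA : ∀ m, MeasurableSet (A m)} (hA0 : ∀ m, sampleLaw ε ϱ N (A m) ≠ 0)
    {u : Fin M → Ω → ProbabilityMeasure S} (hu : IsWeightedSimulation P κ ε ϱ A hA u) (m : Fin M)
    {G : (Fin m → ProbabilityMeasure S) × ProbabilityMeasure S → ℝ≥0∞} (hG : Measurable G) :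
    ∫⁻ ω, rowWeightSum κ ε ϱ (A m) (fun j : Fin m => u (Fin.castLE m.2.le j) ω) *
        G (fun j => u (Fin.castLE m.2.le j) ω, u m ω) ∂P =
      ∫⁻ ω, ∫⁻ z, oldWeight (A m) z * G (fun j => u (Fin.castLE m.2.le j) ω, z)
        ∂(posteriorParam ((κ : ℝ≥0∞) • dirichletLaw ((ε : ℝ≥0∞) • (ϱ : Measure S)))
          fun j => u (Fin.castLE m.2.le j) ω) ∂P := by
  have hum := hu.measurable
  have hupast : Measurable fun ω (i : Iio m) => u i ω := measurable_pi_lambda _ fun i => hum i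
  have hlaw := (hu.law m).map_eq
  let e := finEquivIio m
  have he : Measurable fun (p : Iio m → ProbabilityMeasure S) (j : Fin m) => p (e j) := by fun_prop
  let H : (Iio m → ProbabilityMeasure S) × ProbabilityMeasure S → ℝ≥0∞ := fun q =>
    rowWeightSum κ ε ϱ (A m) q.1 * G (fun j => q.1 (e j), q.2)
  have hG' : Measurable fun q : (Iio m → ProbabilityMeasure S) × ProbabilityMeasure S =>
      G (fun j => q.1 (e j), q.2) := hG.comp ((he.comp measurable_fst).prodMk measurable_snd)
  have hH : Measurable H := ((measurable_rowWeightSum (hA m) _).comp measurable_fst).mul hG'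
  calc _ = ∫⁻ ω, H (fun i : Iio m => u i ω, u m ω) ∂P := by
        refine lintegral_congr fun ω => ?_
        congr 1
        exact rowWeightSum_comp_equiv (A m) e fun i : Iio m => u i ω
    _ = ∫⁻ q, H q ∂(P.map fun ω => (fun i : Iio m => u i ω, u m ω)) := by
        rw [lintegral_map hH (hupast.prodMk (hum m))]
    _ = ∫⁻ ω, ∫⁻ z, H (fun i : Iio m => u i ω, z)
          ∂(simulationKernel κ ε ϱ (A m) (hA m) (Iio m) fun i : Iio m => u i ω) ∂P := by
        rw [hlaw, Measure.lintegral_compProd hH, lintegral_map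
          (f := fun p => ∫⁻ z, H (p, z) ∂(simulationKernel κ ε ϱ (A m) (hA m) (Iio m) p))
          hH.lintegral_kernel_prod_right' hupast]
    _ = _ := by
        refine lintegral_congr fun ω => ?_
        simp only [H]
        have hz : Measurable fun z => G (fun j => u (e j) ω, z) := by fun_prop
        rw [lintegral_const_mul _ hz, rowWeightSum_mul_lintegral_simulationKernel hκ h (hA m)
          (hA0 m) _ hz, ← e.sum_comp]
        rfl

/-- Unbiasedness of the weights, by induction on the number of rows. Each step trades a factor of
the weight for a likelihood factor and one Pólya urn step. -/
theorem IsWeightedSimulation.lintegral_partialWeight {Ω : Type*} [MeasurableSpace Ω]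
    {P : Measure Ω} [IsProbabilityMeasure P] (hκ : 0 < κ)
    (h : IsDirichletLaw ((ε : ℝ≥0∞) • (ϱ : Measure S))
      (dirichletLaw ((ε : ℝ≥0∞) • (ϱ : Measure S))))
    (h' : IsDirichletLaw ((κ : ℝ≥0∞) • dirichletLaw ((ε : ℝ≥0∞) • (ϱ : Measure S)))
      (dirichletLaw ((κ : ℝ≥0∞) • dirichletLaw ((ε : ℝ≥0∞) • (ϱ : Measure S)))))
    {M N : ℕ} {A : Fin M → Set (Fin N → S)}
    {hA : ∀ m, MeasurableSet (A m)} (hA0 : ∀ m, sampleLaw ε ϱ N (A m) ≠ 0)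
    {u : Fin M → Ω → ProbabilityMeasure S} (hu : IsWeightedSimulation P κ ε ϱ A hA u)
    {m : ℕ} (hm : m ≤ M) {F : (Fin m → ProbabilityMeasure S) → ℝ≥0∞} (hF : Measurable F) :
    ∫⁻ ω, partialWeight κ ε ϱ A hm (fun j => u (Fin.castLE hm j) ω) *
        F (fun j => u (Fin.castLE hm j) ω) ∂P =
      ∫⁻ v, (∏ i : Fin m, oldWeight (A (Fin.castLE hm i)) (v i)) * F v
        ∂(mixLaw (dirichletLaw ((κ : ℝ≥0∞) • dirichletLaw ((ε : ℝ≥0∞) • (ϱ : Measure S)))) m) := by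
  have hp := h.isProbabilityMeasure
  have hp' := h'.isProbabilityMeasure
  have hum := hu.measurable
  have hw := fun m => measurable_oldWeight (hA m)
  induction m with
  | zero =>
    rw [lintegral_mixLaw _ _ (by fun_prop)]
    have : ∀ v : Fin 0 → ProbabilityMeasure S, F v = F finZeroElim := fun v => by
      congr 1; exact Subsingleton.elim _ _
    simp [partialWeight, this]
  | succ m ih =>
    have hm' : m ≤ M := m.le_succ.trans hm
    have hW := measurable_partialWeight (κ := κ) (ε := ε) (ϱ := ϱ) hA hm'
    set α := (κ : ℝ≥0∞) • dirichletLaw ((ε : ℝ≥0∞) • (ϱ : Measure S)) with hα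
    have hαfin : IsFiniteMeasure α := h'.isFiniteMeasure
    -- Hence the urn normaliser after `m` rows is `κ + m`, which is the denominator in the weight.
    have hαu : α univ = κ := by simp [hα]
    have happ : ∀ ω, (fun j : Fin (m + 1) => u (Fin.castLE hm j) ω) =
        append (fun j => u (Fin.castLE hm' j) ω) (u ⟨m, hm⟩ ω) := fun ω =>
      (append_init fun j : Fin (m + 1) => u (Fin.castLE hm j) ω).symm
    have hFa : Measurable fun q : (Fin m → ProbabilityMeasure S) × ProbabilityMeasure S =>
        oldWeight (A ⟨m, hm⟩) q.2 * F (append q.1 q.2) := by fun_prop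
    have hmF := measurable_lintegral_posteriorParam α hFa
    calc ∫⁻ ω, partialWeight κ ε ϱ A hm (fun j => u (Fin.castLE hm j) ω) *
            F (fun j => u (Fin.castLE hm j) ω) ∂P
        = ∫⁻ ω, rowWeightSum κ ε ϱ (A ⟨m, hm⟩) (fun j : Fin m => u (Fin.castLE hm' j) ω) *
            (partialWeight κ ε ϱ A hm' (fun j => u (Fin.castLE hm' j) ω) * ((κ : ℝ≥0∞) + m)⁻¹ *
              F (append (fun j => u (Fin.castLE hm' j) ω) (u ⟨m, hm⟩ ω))) ∂P := by
          refine lintegral_congr fun ω => ?_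
          rw [happ, partialWeight_append]
          ring
      _ = ∫⁻ ω, ∫⁻ z, oldWeight (A ⟨m, hm⟩) z *
            (partialWeight κ ε ϱ A hm' (fun j => u (Fin.castLE hm' j) ω) * ((κ : ℝ≥0∞) + m)⁻¹ *
              F (append (fun j => u (Fin.castLE hm' j) ω) z))
            ∂(posteriorParam α fun j => u (Fin.castLE hm' j) ω) ∂P :=
          hu.lintegral_step hκ h hA0 ⟨m, hm⟩
            (G := fun q => partialWeight κ ε ϱ A hm' q.1 * ((κ : ℝ≥0∞) + m)⁻¹ *
              F (append q.1 q.2)) (by fun_prop)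
      _ = ∫⁻ ω, partialWeight κ ε ϱ A hm' (fun j => u (Fin.castLE hm' j) ω) *
            (((κ : ℝ≥0∞) + m)⁻¹ * ∫⁻ z, oldWeight (A ⟨m, hm⟩) z *
              F (append (fun j => u (Fin.castLE hm' j) ω) z)
              ∂(posteriorParam α fun j => u (Fin.castLE hm' j) ω)) ∂P := by
          refine lintegral_congr fun ω => ?_
          rw [← mul_assoc, ← lintegral_const_mul _ (by fun_prop)]
          exact lintegral_congr fun z => by ring
      _ = _ := ih hm' (F := fun v => ((κ : ℝ≥0∞) + m)⁻¹ *
            ∫⁻ z, oldWeight (A ⟨m, hm⟩) z * F (append v z) ∂(posteriorParam α v))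
            (hmF.const_mul _)
      _ = _ := by
          rw [h'.lintegral_mixLaw_succ (by fun_prop)]
          refine lintegral_congr fun v => ?_
          rw [hαu, mul_left_comm, ← lintegral_const_mul _ (by fun_prop)]
          congr 1
          refine lintegral_congr fun z => ?_
          rw [Fin.prod_univ_castSucc]
          simp only [append_castSucc, append_last]
          rw [mul_assoc]
          rfl

theorem IsWeightedSimulation.lintegral_totalWeight {Ω : Type*} [MeasurableSpace Ω]
    {P : Measure Ω} [IsProbabilityMeasure P] (hκ : 0 < κ)
    (h : IsDirichletLaw ((ε : ℝ≥0∞) • (ϱ : Measure S))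
      (dirichletLaw ((ε : ℝ≥0∞) • (ϱ : Measure S))))
    (h' : IsDirichletLaw ((κ : ℝ≥0∞) • dirichletLaw ((ε : ℝ≥0∞) • (ϱ : Measure S)))
      (dirichletLaw ((κ : ℝ≥0∞) • dirichletLaw ((ε : ℝ≥0∞) • (ϱ : Measure S)))))
    {M N : ℕ} {A : Fin M → Set (Fin N → S)}
    {hA : ∀ m, MeasurableSet (A m)} (hA0 : ∀ m, sampleLaw ε ϱ N (A m) ≠ 0)
    {u : Fin M → Ω → ProbabilityMeasure S} (hu : IsWeightedSimulation P κ ε ϱ A hA u)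
    {F : (Fin M → ProbabilityMeasure S) → ℝ≥0∞} (hF : Measurable F) :
    ∫⁻ ω, totalWeight κ ε ϱ A (fun j => u j ω) * F (fun j => u j ω) ∂P =
      ∫⁻ v, (∏ i, oldWeight (A i) (v i)) * F v
        ∂(mixLaw (dirichletLaw ((κ : ℝ≥0∞) • dirichletLaw ((ε : ℝ≥0∞) • (ϱ : Measure S)))) M) := by
  simp_rw [totalWeight_eq_partialWeight]
  exact hu.lintegral_partialWeight hκ h h' hA0 le_rfl hF

theorem measurable_totalWeight {M N : ℕ} {A : Fin M → Set (Fin N → S)}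
    (hA : ∀ m, MeasurableSet (A m)) : Measurable (totalWeight κ ε ϱ A) := by
  simp_rw [funext (totalWeight_eq_partialWeight (κ := κ) (ε := ε) (ϱ := ϱ) A)]
  exact measurable_partialWeight hA le_rfl

theorem totalWeight_ne_zero (hκ : 0 < κ) {M N : ℕ} {A : Fin M → Set (Fin N → S)}
    (hA0 : ∀ m, sampleLaw ε ϱ N (A m) ≠ 0) (v : Fin M → ProbabilityMeasure S) :
    totalWeight κ ε ϱ A v ≠ 0 := by
  refine Finset.prod_ne_zero_iff.2 fun m _ => mul_ne_zero ?_ (rowWeightSum_ne_zero hκ (hA0 m) _)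
  simp

theorem totalWeight_le_one {M N : ℕ} (A : Fin M → Set (Fin N → S))
    (v : Fin M → ProbabilityMeasure S) : totalWeight κ ε ϱ A v ≤ 1 := by
  rw [totalWeight_eq_partialWeight]
  refine Finset.prod_le_one' fun m _ => ?_
  refine (mul_le_mul_right (rowWeightSum_le _ _) _).trans ?_
  simp [ENNReal.inv_mul_le_one]

end Simulation

/-! ### The joint law of the rows and the observations -/

section Observations

variable {S : Type*} [MeasurableSpace S] {κ ε : ℝ≥0} {ϱ : ProbabilityMeasure S}

theorem infinitePi_map_fin {X : Type*} [MeasurableSpace X] (ν : ProbabilityMeasure X) (k : ℕ) :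
    (Measure.infinitePi fun _ : ℕ => (ν : Measure X)).map (fun x (i : Fin k) => x i) =
      iidLaw k ν := by
  have h := Measure.map_infinitePi_infinitePi_of_inj (P := fun _ : ℕ => (ν : Measure X))
    (f := fun i : Fin k => (i : ℕ)) Fin.val_injective
  rw [h, Measure.infinitePi_eq_pi]
  rfl

/-- The entries used form an `M × N` block of independent coordinates; currying it gives `M`
independent rows with laws `(ν m)^N`. -/
theorem infinitePi_row_events {M N : ℕ} {A : Fin M → Set (Fin N → S)}
    (hA : ∀ m, MeasurableSet (A m)) (ν : ℕ → ProbabilityMeasure S) :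
    (Measure.infinitePi fun p : ℕ × ℕ => (ν p.1 : Measure S))
        {x | ∀ m : Fin M, (fun j : Fin N => x (m, j)) ∈ A m} =
      ∏ m : Fin M, oldWeight (A m) (ν m) := by
  have hinj : Function.Injective fun p : Fin M × Fin N => ((p.1 : ℕ), (p.2 : ℕ)) := by
    rintro ⟨a, b⟩ ⟨c, d⟩ hp
    simpa [Fin.ext_iff] using hp
  have h := Measure.map_infinitePi_infinitePi_of_inj
    (P := fun p : ℕ × ℕ => (ν p.1 : Measure S)) hinj
  have h2 := Measure.infinitePi_map_curry
    (fun (m : Fin M) (_ : Fin N) => (ν m : Measure S))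
  simp only [Measure.infinitePi_eq_pi] at h2
  rw [← Measure.infinitePi_eq_pi, ← h, Measure.map_map (MeasurableEquiv.measurable _)
    (by fun_prop)] at h2
  have h3 := congrArg (fun m => m (univ.pi A)) h2
  rw [Measure.pi_pi, Measure.map_apply ((MeasurableEquiv.measurable _).comp (by fun_prop))
    (.univ_pi hA)] at h3
  refine Eq.trans ?_ h3
  congr 1
  ext x
  simp only [mem_preimage, Set.mem_pi, mem_univ, true_implies]
  rfl

variable {Ω : Type*} [MeasurableSpace Ω] {P : Measure Ω} [IsProbabilityMeasure P]
  {ϖ : Ω → ProbabilityMeasure (ProbabilityMeasure S)} {μ : ℕ → Ω → ProbabilityMeasure S}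
  {ξ : ℕ → ℕ → Ω → S}

/-- Existence comes from the array itself: the law of `ϖ` is a probability measure, which rules out
the default value `0` of `dirichletLaw`. -/
theorem IsNestedDirichletArray.isDirichletLaw_generator
    (hξ : IsNestedDirichletArray P κ ε ϱ ϖ μ ξ) :
    IsDirichletLaw ((κ : ℝ≥0∞) • dirichletLaw ((ε : ℝ≥0∞) • (ϱ : Measure S)))
      (dirichletLaw ((κ : ℝ≥0∞) • dirichletLaw ((ε : ℝ≥0∞) • (ϱ : Measure S)))) := by
  refine isDirichletLaw_dirichletLaw ?_
  rw [← hξ.law_generator.map_eq]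
  have := Measure.isProbabilityMeasure_map (μ := P) hξ.measurable_generator.aemeasurable
  exact IsProbabilityMeasure.ne_zero _

/-- Were `𝒟(ε ϱ)` the default `0`, the parameter of the law of `ϖ` would have no mass. -/
theorem IsNestedDirichletArray.isDirichletLaw_row
    (hξ : IsNestedDirichletArray P κ ε ϱ ϖ μ ξ) :
    IsDirichletLaw ((ε : ℝ≥0∞) • (ϱ : Measure S))
      (dirichletLaw ((ε : ℝ≥0∞) • (ϱ : Measure S))) := by
  refine isDirichletLaw_dirichletLaw fun h0 => ?_
  have := hξ.isDirichletLaw_generator.real_univ_pos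
  rw [h0] at this
  simp at this

theorem IsNestedDirichletArray.lintegral_rows (hξ : IsNestedDirichletArray P κ ε ϱ ϖ μ ξ)
    (k : ℕ) {F : (Fin k → ProbabilityMeasure S) → ℝ≥0∞} (hF : Measurable F) :
    ∫⁻ ω, F (fun i => μ i ω) ∂P = ∫⁻ v, F v
      ∂(mixLaw (dirichletLaw ((κ : ℝ≥0∞) • dirichletLaw ((ε : ℝ≥0∞) • (ϱ : Measure S)))) k) := by
  have hϖ := hξ.measurable_generator
  have hμ : Measurable fun ω i => μ i ω := measurable_pi_lambda _ hξ.measurable_row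
  have hF' : Measurable fun q : ProbabilityMeasure (ProbabilityMeasure S) ×
      (ℕ → ProbabilityMeasure S) => F fun i : Fin k => q.2 i := by fun_prop
  rw [lintegral_mixLaw _ _ hF, ← hξ.law_generator.map_eq]
  calc ∫⁻ ω, F (fun i => μ i ω) ∂P
      = ∫⁻ q, F (fun i : Fin k => q.2 i) ∂(P.map fun ω => (ϖ ω, fun i => μ i ω)) := by
        rw [lintegral_map hF' (hϖ.prodMk hμ)]
    _ = _ := by
        rw [hξ.law_rows.map_eq, Measure.lintegral_compProd hF']
        refine lintegral_congr fun D => ?_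
        rw [← infinitePi_map_fin, lintegral_map hF (by fun_prop)]
        rfl

/-- Integrating out the entries given the rows replaces the indicator of the observed event by its
likelihood. -/
theorem IsNestedDirichletArray.lintegral_rows_observations
    (hξ : IsNestedDirichletArray P κ ε ϱ ϖ μ ξ) {M N : ℕ} {A : Fin M → Set (Fin N → S)}
    (hA : ∀ m, MeasurableSet (A m)) {f : (ℕ → ProbabilityMeasure S) → ℝ≥0∞} (hf : Measurable f) :
    ∫⁻ ω in {ω | ∀ m : Fin M, (fun j : Fin N => ξ m j ω) ∈ A m}, f (fun i => μ i ω) ∂P =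
      ∫⁻ ω, (∏ m : Fin M, oldWeight (A m) (μ m ω)) * f (fun i => μ i ω) ∂P := by
  have hϖ := hξ.measurable_generator
  have hμ : Measurable fun ω i => μ i ω := measurable_pi_lambda _ hξ.measurable_row
  have hξm : Measurable fun ω (p : ℕ × ℕ) => ξ p.1 p.2 ω :=
    measurable_pi_lambda _ fun p => hξ.measurable_entry p.1 p.2
  have hE : MeasurableSet {x : ℕ × ℕ → S | ∀ m : Fin M, (fun j : Fin N => x (m, j)) ∈ A m} := by
    rw [show {x : ℕ × ℕ → S | ∀ m : Fin M, (fun j : Fin N => x (m, j)) ∈ A m} =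
      ⋂ m : Fin M, (fun x j => x ((m : ℕ), ((j : Fin N) : ℕ))) ⁻¹' A m by ext; simp]
    exact MeasurableSet.iInter fun m => (by fun_prop : Measurable
      fun (x : ℕ × ℕ → S) (j : Fin N) => x ((m : ℕ), (j : ℕ))) (hA m)
  set E := {x : ℕ × ℕ → S | ∀ m : Fin M, (fun j : Fin N => x (m, j)) ∈ A m}
  let G : (ProbabilityMeasure (ProbabilityMeasure S) × (ℕ → ProbabilityMeasure S)) ×
      (ℕ × ℕ → S) → ℝ≥0∞ := fun q => E.indicator 1 q.2 * f q.1.2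
  have hG : Measurable G := ((measurable_one.indicator hE).comp measurable_snd).mul
    (hf.comp (measurable_snd.comp measurable_fst))
  have hE' : {ω | ∀ m : Fin M, (fun j : Fin N => ξ m j ω) ∈ A m} =
      (fun ω (p : ℕ × ℕ) => ξ p.1 p.2 ω) ⁻¹' E := rfl
  rw [hE', ← lintegral_indicator (hξm hE)]
  calc _ = ∫⁻ ω, G ((ϖ ω, fun i => μ i ω), fun p => ξ p.1 p.2 ω) ∂P := by
        refine lintegral_congr fun ω => ?_
        by_cases hω : (fun p : ℕ × ℕ => ξ p.1 p.2 ω) ∈ E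
        · rw [indicator_of_mem (show ω ∈ _ from hω)]
          simp [G, hω]
        · rw [indicator_of_notMem (show ω ∉ _ from hω)]
          simp [G, hω]
    _ = ∫⁻ q, G q ∂(P.map fun ω => ((ϖ ω, fun i => μ i ω), fun p : ℕ × ℕ => ξ p.1 p.2 ω)) := by
        rw [lintegral_map hG ((hϖ.prodMk hμ).prodMk hξm)]
    _ = ∫⁻ q, (∏ m : Fin M, oldWeight (A m) (q.2 m)) * f q.2
          ∂(P.map fun ω => (ϖ ω, fun i => μ i ω)) := by
        rw [hξ.law_entries.map_eq, Measure.lintegral_compProd hG]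
        refine lintegral_congr fun q => ?_
        simp only [G]
        rw [lintegral_mul_const _ (measurable_one.indicator hE), lintegral_indicator_one hE]
        congr 1
        exact infinitePi_row_events hA q.2
    _ = _ := by
        have hw := fun m => measurable_oldWeight (hA m)
        rw [lintegral_map (by fun_prop) (hϖ.prodMk hμ)]

/-- The joint law of the first `M` rows, weighted by the likelihood of the observations. -/
def rowLikelihood (κ ε : ℝ≥0) (ϱ : ProbabilityMeasure S) {M N : ℕ} (A : Fin M → Set (Fin N → S)) :
    Measure (Fin M → ProbabilityMeasure S) :=
  (mixLaw (dirichletLaw ((κ : ℝ≥0∞) • dirichletLaw ((ε : ℝ≥0∞) • (ϱ : Measure S)))) M).withDensity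
    fun v => ∏ m, oldWeight (A m) (v m)

theorem measurable_prod_oldWeight {M N : ℕ} {A : Fin M → Set (Fin N → S)}
    (hA : ∀ m, MeasurableSet (A m)) :
    Measurable fun v : Fin M → ProbabilityMeasure S => ∏ m, oldWeight (A m) (v m) := by
  have hw := fun m => measurable_oldWeight (hA m)
  fun_prop

theorem lintegral_rowLikelihood {M N : ℕ} {A : Fin M → Set (Fin N → S)}
    (hA : ∀ m, MeasurableSet (A m)) {F : (Fin M → ProbabilityMeasure S) → ℝ≥0∞}
    (hF : Measurable F) :
    ∫⁻ v, F v ∂(rowLikelihood κ ε ϱ A) = ∫⁻ v, (∏ m, oldWeight (A m) (v m)) * F v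
      ∂(mixLaw (dirichletLaw ((κ : ℝ≥0∞) •
        dirichletLaw ((ε : ℝ≥0∞) • (ϱ : Measure S)))) M) := by
  rw [rowLikelihood, lintegral_withDensity_eq_lintegral_mul _ (measurable_prod_oldWeight hA) hF]
  rfl

/-- The next row together with the observations, by the Pólya urn scheme. -/
theorem IsNestedDirichletArray.measure_next_row_observations
    (hξ : IsNestedDirichletArray P κ ε ϱ ϖ μ ξ) {M N : ℕ} {A : Fin M → Set (Fin N → S)}
    (hA : ∀ m, MeasurableSet (A m)) {B : Set (ProbabilityMeasure S)} (hB : MeasurableSet B) :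
    P ({ω | ∀ m : Fin M, (fun j : Fin N => ξ m j ω) ∈ A m} ∩ μ M ⁻¹' B) =
      ((κ : ℝ≥0∞) + M)⁻¹ * (κ * dirichletLaw ((ε : ℝ≥0∞) • (ϱ : Measure S)) B *
        rowLikelihood κ ε ϱ A univ + ∑ m, rowLikelihood κ ε ϱ A {v | v m ∈ B}) := by
  have h' := hξ.isDirichletLaw_generator
  have h := hξ.isDirichletLaw_row
  have hp := h.isProbabilityMeasure
  have hw := fun m => measurable_oldWeight (hA m)
  have hBi : Measurable (B.indicator (1 : ProbabilityMeasure S → ℝ≥0∞)) :=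
    measurable_one.indicator hB
  have h1 := hξ.lintegral_rows_observations hA (f := fun v => B.indicator 1 (v M)) (by fun_prop)
  -- Rows are numbered from `0`, so `μ M` is the row after the observed ones: last among `M + 1`
  -- rows and absent from the likelihood.
  have h2 := hξ.lintegral_rows (M + 1)
    (F := fun v => (∏ m : Fin M, oldWeight (A m) (v m.castSucc)) * B.indicator 1 (v (Fin.last M)))
    (by fun_prop)
  have hμB : MeasurableSet (μ M ⁻¹' B) := hξ.measurable_row M hB
  have h3 : ∫⁻ ω in {ω | ∀ m : Fin M, (fun j : Fin N => ξ m j ω) ∈ A m},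
      B.indicator 1 (μ M ω) ∂P =
      P ({ω | ∀ m : Fin M, (fun j : Fin N => ξ m j ω) ∈ A m} ∩ μ M ⁻¹' B) := by
    rw [show (fun ω => B.indicator (1 : ProbabilityMeasure S → ℝ≥0∞) (μ M ω)) =
      (μ M ⁻¹' B).indicator 1 from rfl, lintegral_indicator_one hμB, Measure.restrict_apply hμB,
      inter_comm]
  rw [← h3, h1]
  refine h2.trans ?_
  rw [h'.lintegral_mixLaw_succ (by fun_prop)]
  simp only [append_castSucc, append_last]
  have hα : ((κ : ℝ≥0∞) • dirichletLaw ((ε : ℝ≥0∞) • (ϱ : Measure S))) univ = κ := by simp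
  rw [hα]
  have h4 : ∀ v : Fin M → ProbabilityMeasure S, ((κ : ℝ≥0∞) + M)⁻¹ *
      ∫⁻ z, (∏ m, oldWeight (A m) (v m)) * B.indicator 1 z
        ∂(posteriorParam ((κ : ℝ≥0∞) • dirichletLaw ((ε : ℝ≥0∞) • (ϱ : Measure S))) v) =
      (∏ m, oldWeight (A m) (v m)) * (((κ : ℝ≥0∞) + M)⁻¹ *
        (κ * dirichletLaw ((ε : ℝ≥0∞) • (ϱ : Measure S)) B + ∑ m, B.indicator 1 (v m))) := by
    intro v
    rw [lintegral_const_mul _ hBi, lintegral_indicator_one hB, mul_left_comm, posteriorParam]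
    simp only [Measure.add_apply, Measure.smul_apply, Measure.finsetSum_apply, smul_eq_mul,
      Measure.dirac_apply' _ hB]
  simp_rw [h4]
  rw [← lintegral_rowLikelihood hA (F := fun v => ((κ : ℝ≥0∞) + M)⁻¹ *
    (κ * dirichletLaw ((ε : ℝ≥0∞) • (ϱ : Measure S)) B + ∑ m, B.indicator 1 (v m)))
    (by fun_prop), lintegral_const_mul _ (by fun_prop), lintegral_add_left measurable_const,
    lintegral_const, lintegral_finsetSum _ fun m _ => by fun_prop]
  congr 2
  refine Finset.sum_congr rfl fun m _ => ?_
  have hm : MeasurableSet {v : Fin M → ProbabilityMeasure S | v m ∈ B} := measurable_pi_apply m hB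
  rw [← lintegral_indicator_one hm]
  rfl

theorem IsNestedDirichletArray.measure_observations
    (hξ : IsNestedDirichletArray P κ ε ϱ ϖ μ ξ) {M N : ℕ} {A : Fin M → Set (Fin N → S)}
    (hA : ∀ m, MeasurableSet (A m)) :
    P {ω | ∀ m : Fin M, (fun j : Fin N => ξ m j ω) ∈ A m} = rowLikelihood κ ε ϱ A univ := by
  have h1 := hξ.lintegral_rows_observations hA (f := fun _ => 1) measurable_const
  have h2 := hξ.lintegral_rows M (measurable_prod_oldWeight hA)
  rw [setLIntegral_one] at h1
  rw [h1, ← lintegral_one, lintegral_rowLikelihood hA measurable_const]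
  simpa using h2

/-- Each row has marginal law `𝒟(ε ϱ)`, the mean of `ϖ`, so the probability of all observations is
at most `ϱ_N(A m)`. With `κ > 0` this keeps `t_{mm}`, and so every weight, away from zero. -/
theorem IsNestedDirichletArray.sampleLaw_ne_zero
    (hξ : IsNestedDirichletArray P κ ε ϱ ϖ μ ξ) {M N : ℕ} {A : Fin M → Set (Fin N → S)}
    (hA : ∀ m, MeasurableSet (A m))
    (h0 : P {ω | ∀ m : Fin M, (fun j : Fin N => ξ m j ω) ∈ A m} ≠ 0) (m : Fin M) :
    sampleLaw ε ϱ N (A m) ≠ 0 := by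
  intro hm
  refine h0 (le_antisymm ?_ zero_le)
  have h' := hξ.isDirichletLaw_generator
  have hw := fun m => measurable_oldWeight (hA m)
  rw [hξ.measure_observations hA, ← lintegral_one, lintegral_rowLikelihood hA measurable_const]
  simp only [mul_one]
  calc _ ≤ ∫⁻ v, oldWeight (A m) (v m) ∂(mixLaw (dirichletLaw ((κ : ℝ≥0∞) •
        dirichletLaw ((ε : ℝ≥0∞) • (ϱ : Measure S)))) M) := by
        refine lintegral_mono fun v => ?_
        rw [← Finset.mul_prod_erase _ _ (Finset.mem_univ m)]
        exact mul_le_of_le_one_right' (Finset.prod_le_one' fun i _ => oldWeight_le_one _ _)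
    _ = ∫⁻ D, ∫⁻ z, oldWeight (A m) z ∂(D : Measure (ProbabilityMeasure S)) ∂(dirichletLaw
          ((κ : ℝ≥0∞) • dirichletLaw ((ε : ℝ≥0∞) • (ϱ : Measure S)))) := by
        rw [lintegral_mixLaw _ _ (by fun_prop)]
        refine lintegral_congr fun D => ?_
        exact (measurePreserving_eval (fun _ : Fin M => (D : Measure (ProbabilityMeasure S)))
          m).lintegral_comp (hw m)
    _ = 0 := by
        have : ∫⁻ z, oldWeight (A m) z ∂(dirichletLaw ((ε : ℝ≥0∞) • (ϱ : Measure S))) =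
            sampleLaw ε ϱ N (A m) := by
          rw [sampleLaw, Measure.bind_apply (hA m) (measurable_iidLaw N).aemeasurable]
          rfl
        rw [h'.lintegral_mean (hw m), lintegral_smul_measure, this, hm, smul_zero, mul_zero]
    _ ≤ 0 := le_rfl

end Observations

/-! ### Convergence of weighted empirical laws -/

section Convergence

/-- The strong law of large numbers, carried over to `ℝ≥0∞`; the bound by `1` provides integrability
and permits the passage to real values. -/
theorem tendsto_inv_mul_sum_lintegral {Ω Z : Type*} [MeasurableSpace Ω] [MeasurableSpace Z]
    {P : Measure Ω} [IsProbabilityMeasure P] {u : ℕ → Ω → Z} (hu : ∀ k, Measurable (u k))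
    (hindep : iIndepFun u P) (hlaw : ∀ k, P.map (u k) = P.map (u 0)) {g : Z → ℝ≥0∞}
    (hg : Measurable g) (hg1 : ∀ z, g z ≤ 1) :
    ∀ᵐ ω ∂P, Tendsto (fun K : ℕ => (K : ℝ≥0∞)⁻¹ * ∑ k ∈ Finset.range K, g (u k ω)) atTop
      (𝓝 (∫⁻ ω, g (u 0 ω) ∂P)) := by
  have hfin : ∀ z, g z ≠ ∞ := fun z => ne_top_of_le_ne_top ENNReal.one_ne_top (hg1 z)
  have hgr : Measurable fun z => (g z).toReal := hg.ennreal_toReal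
  have hint : Integrable (fun ω => (g (u 0 ω)).toReal) P := by
    refine Integrable.of_bound (hgr.comp (hu 0)).aestronglyMeasurable 1 (ae_of_all _ fun ω => ?_)
    rw [Real.norm_of_nonneg ENNReal.toReal_nonneg]
    exact ENNReal.toReal_le_of_le_ofReal zero_le_one (by simpa using hg1 (u 0 ω))
  have h := strong_law_ae_real (fun k ω => (g (u k ω)).toReal) hint
    (fun i j hij => (hindep.indepFun hij).comp hgr hgr)
    (fun k => (IdentDistrib.mk (hu k).aemeasurable (hu 0).aemeasurable (hlaw k)).comp hgr)
  filter_upwards [h] with ω hω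
  have h1 := ENNReal.tendsto_ofReal hω
  rw [integral_toReal (f := fun ω => g (u 0 ω)) (hg.comp (hu 0)).aemeasurable (ae_of_all _ fun ω => (hfin _).lt_top),
    ENNReal.ofReal_toReal] at h1
  · refine h1.congr' ?_
    filter_upwards [eventually_gt_atTop 0] with K hK
    rw [ENNReal.ofReal_div_of_pos (by exact_mod_cast hK), ENNReal.ofReal_natCast,
      ENNReal.ofReal_sum_of_nonneg fun k _ => ENNReal.toReal_nonneg, ENNReal.div_eq_inv_mul]
    congr 1
    exact Finset.sum_congr rfl fun k _ => ENNReal.ofReal_toReal (hfin _)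
  · refine ne_top_of_le_ne_top ENNReal.one_ne_top ?_
    exact (lintegral_mono fun ω => hg1 _).trans (by simp)

variable {E : Type*} [MeasurableSpace E]

theorem weightedEmpirical_apply (V : ℕ → ℝ≥0∞) (x : ℕ → E) (K : ℕ) {U : Set E}
    (hU : MeasurableSet U) :
    weightedEmpirical V x K U = (∑ k ∈ Finset.range K, V k)⁻¹ *
      ∑ k ∈ Finset.range K, V k * U.indicator 1 (x k) := by
  simp [weightedEmpirical, Measure.dirac_apply' _ hU]

theorem newRowApprox_apply (κ : ℝ≥0) {M : ℕ} (D : Measure E) (V : ℕ → ℝ≥0∞)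
    (x : ℕ → Fin M → E) (K : ℕ) (U : Set E) :
    newRowApprox κ D V x K U = ((κ : ℝ≥0∞) + M)⁻¹ *
      (κ * D U + ∑ m, weightedEmpirical V (fun k => x k m) K U) := by
  simp [newRowApprox, mul_add]

theorem newRowApprox_map {E' : Type*} [MeasurableSpace E'] (κ : ℝ≥0) {M : ℕ} (D : Measure E)
    (V : ℕ → ℝ≥0∞) (x : ℕ → Fin M → E) (K : ℕ) {Φ : E → E'} (hΦ : Measurable Φ) :
    (newRowApprox κ D V x K).map Φ = newRowApprox κ (D.map Φ) V (fun k m => Φ (x k m)) K := by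
  ext U hU
  rw [Measure.map_apply hΦ hU, newRowApprox_apply, newRowApprox_apply, Measure.map_apply hΦ hU]
  simp_rw [weightedEmpirical_apply _ _ _ hU, weightedEmpirical_apply _ _ _ (hΦ hU)]
  rfl

theorem isProbabilityMeasure_newRowApprox {κ : ℝ≥0} (hκ : 0 < κ) {M : ℕ} (D : Measure E)
    [IsProbabilityMeasure D] {V : ℕ → ℝ≥0∞} (hV0 : ∀ k, V k ≠ 0) (hV : ∀ k, V k ≠ ∞)
    (x : ℕ → Fin M → E) (K : ℕ) : IsProbabilityMeasure (newRowApprox κ D V x (K + 1)) := by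
  refine ⟨?_⟩
  -- The term `k = 0` is present because the index is `K + 1`; with an empty sum the normalisation
  -- would fail.
  have h1 : ∑ k ∈ Finset.range (K + 1), V k ≠ 0 :=
    fun h => hV0 0 (Finset.sum_eq_zero_iff.1 h 0 (by simp))
  have h2 : ∑ k ∈ Finset.range (K + 1), V k ≠ ∞ := ENNReal.sum_ne_top.2 fun k _ => hV k
  rw [newRowApprox_apply]
  simp_rw [weightedEmpirical_apply _ _ _ MeasurableSet.univ]
  simp only [measure_univ, indicator_univ, Pi.one_apply, mul_one, ENNReal.inv_mul_cancel h1 h2,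
    Finset.sum_const, Finset.card_univ, Fintype.card_fin, nsmul_eq_mul]
  refine ENNReal.inv_mul_cancel ?_ (by simp)
  have : (κ : ℝ≥0∞) ≠ 0 := by exact_mod_cast hκ.ne'
  simp [this]

theorem tendsto_weightedEmpirical {V : ℕ → ℝ≥0∞} {x : ℕ → E} {U : Set E} (hU : MeasurableSet U)
    {a b : ℝ≥0∞} (ha : a ≠ 0) (hb : b ≠ ∞)
    (h1 : Tendsto (fun K : ℕ => (K : ℝ≥0∞)⁻¹ * ∑ k ∈ Finset.range K, V k) atTop (𝓝 a))
    (h2 : Tendsto (fun K : ℕ => (K : ℝ≥0∞)⁻¹ *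
      ∑ k ∈ Finset.range K, V k * U.indicator 1 (x k)) atTop (𝓝 b)) :
    Tendsto (fun K => weightedEmpirical V x K U) atTop (𝓝 (a⁻¹ * b)) := by
  have h3 := ENNReal.Tendsto.mul (tendsto_inv_iff.2 h1) (Or.inr hb) h2
    (Or.inr (ENNReal.inv_ne_top.2 ha))
  refine h3.congr' ?_
  filter_upwards [eventually_gt_atTop 0] with K hK
  have hK0 : (K : ℝ≥0∞) ≠ 0 := by exact_mod_cast hK.ne'
  rw [weightedEmpirical_apply _ _ _ hU, ENNReal.mul_inv (Or.inl (by simp)) (Or.inl (by simpa using hK.ne')),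
    inv_inv, mul_mul_mul_comm, ENNReal.mul_inv_cancel hK0 (by simp), one_mul]

end Convergence

/-! ### Identification of the almost sure limit. -/

section Simulation

variable {S : Type*} [MeasurableSpace S] {κ ε : ℝ≥0} {ϱ : ProbabilityMeasure S}
  {Ω Ω' : Type*} [MeasurableSpace Ω] [MeasurableSpace Ω']
  {P : Measure Ω} [IsProbabilityMeasure P] {P' : Measure Ω'} [IsProbabilityMeasure P']
  {ϖ : Ω → ProbabilityMeasure (ProbabilityMeasure S)} {μ : ℕ → Ω → ProbabilityMeasure S}
  {ξ : ℕ → ℕ → Ω → S}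

theorem IsWeightedSimulation.lintegral_totalWeight_mul (hκ : 0 < κ)
    (hξ : IsNestedDirichletArray P κ ε ϱ ϖ μ ξ) {M N : ℕ} {A : Fin M → Set (Fin N → S)}
    {hA : ∀ m, MeasurableSet (A m)} (hA0 : ∀ m, sampleLaw ε ϱ N (A m) ≠ 0)
    {u : Fin M → Ω' → ProbabilityMeasure S} (hu : IsWeightedSimulation P' κ ε ϱ A hA u)
    {F : (Fin M → ProbabilityMeasure S) → ℝ≥0∞} (hF : Measurable F) :
    ∫⁻ ω, totalWeight κ ε ϱ A (fun j => u j ω) * F (fun j => u j ω) ∂P' =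
      ∫⁻ v, F v ∂(rowLikelihood κ ε ϱ A) := by
  rw [lintegral_rowLikelihood hA hF, hu.lintegral_totalWeight hκ hξ.isDirichletLaw_row
    hξ.isDirichletLaw_generator hA0 hF]

/-- As the total weight is neither zero nor infinite, one may divide by it in the unbiasedness
identity. The right side involves no particular simulation, so the independent simulations are
identically distributed. -/
theorem IsWeightedSimulation.map_eq (hκ : 0 < κ)
    (hξ : IsNestedDirichletArray P κ ε ϱ ϖ μ ξ) {M N : ℕ} {A : Fin M → Set (Fin N → S)}
    {hA : ∀ m, MeasurableSet (A m)} (hA0 : ∀ m, sampleLaw ε ϱ N (A m) ≠ 0)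
    {u : Fin M → Ω' → ProbabilityMeasure S} (hu : IsWeightedSimulation P' κ ε ϱ A hA u) :
    P'.map (fun ω m => u m ω) =
      (rowLikelihood κ ε ϱ A).withDensity fun v => (totalWeight κ ε ϱ A v)⁻¹ := by
  have hV := measurable_totalWeight (κ := κ) (ε := ε) (ϱ := ϱ) hA
  have hVi : Measurable fun v => (totalWeight κ ε ϱ A v)⁻¹ := hV.inv
  have hum : Measurable fun ω m => u m ω := measurable_pi_lambda _ hu.measurable
  refine Measure.ext_of_lintegral _ fun F hF => ?_
  rw [lintegral_map hF hum, lintegral_withDensity_eq_lintegral_mul _ hVi hF]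
  refine Eq.trans (lintegral_congr fun ω => ?_) (hu.lintegral_totalWeight_mul hκ hξ hA0
    (F := fun v => (totalWeight κ ε ϱ A v)⁻¹ * F v) (hVi.mul hF))
  rw [← mul_assoc, ENNReal.mul_inv_cancel (totalWeight_ne_zero hκ hA0 _)
    (ne_top_of_le_ne_top ENNReal.one_ne_top (totalWeight_le_one _ _)), one_mul]

theorem IsNestedDirichletArray.ae_tendsto_newRowApprox (hκ : 0 < κ)
    (hξ : IsNestedDirichletArray P κ ε ϱ ϖ μ ξ) {M N : ℕ} {A : Fin M → Set (Fin N → S)}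
    {hA : ∀ m, MeasurableSet (A m)}
    (h0 : P {ω | ∀ m : Fin M, (fun j : Fin N => ξ m j ω) ∈ A m} ≠ 0)
    {u : ℕ → Fin M → Ω' → ProbabilityMeasure S}
    (hu : ∀ k, IsWeightedSimulation P' κ ε ϱ A hA (u k))
    (hindep : iIndepFun (fun k ω m => u k m ω) P')
    {B : Set (ProbabilityMeasure S)} (hB : MeasurableSet B) :
    ∀ᵐ ω ∂P', Tendsto (fun K => newRowApprox κ
      (dirichletLaw ((ε : ℝ≥0∞) • (ϱ : Measure S)))
      (fun k => totalWeight κ ε ϱ A fun m => u k m ω) (fun k m => u k m ω) K B) atTop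
      (𝓝 ((ProbabilityTheory.cond P
        {ω | ∀ m : Fin M, (fun j : Fin N => ξ m j ω) ∈ A m}).map (μ M) B)) := by
  have hA0 := hξ.sampleLaw_ne_zero hA h0
  have hV := measurable_totalWeight (κ := κ) (ε := ε) (ϱ := ϱ) hA
  have hum : ∀ k, Measurable fun ω m => u k m ω := fun k =>
    measurable_pi_lambda _ (hu k).measurable
  have hlaw : ∀ k, P'.map (fun ω m => u k m ω) = P'.map (fun ω m => u 0 m ω) := fun k => by
    rw [(hu k).map_eq hκ hξ hA0, (hu 0).map_eq hκ hξ hA0]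
  have hRE := hξ.measure_observations hA
  set ρ := rowLikelihood κ ε ϱ A
  have hρ0 : ρ univ ≠ 0 := by rwa [← hRE]
  have hρfin : ρ univ ≠ ∞ := by
    rw [← hRE]
    exact measure_ne_top _ _
  -- The strong law for `V F(u)`: `F = 1` gives the denominators and the indicators of `v m ∈ B`
  -- give the numerators.
  have key : ∀ F : (Fin M → ProbabilityMeasure S) → ℝ≥0∞, Measurable F → (∀ v, F v ≤ 1) →
      ∀ᵐ ω ∂P', Tendsto (fun K : ℕ => (K : ℝ≥0∞)⁻¹ * ∑ k ∈ Finset.range K,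
        totalWeight κ ε ϱ A (fun m => u k m ω) * F fun m => u k m ω) atTop
        (𝓝 (∫⁻ v, F v ∂ρ)) := by
    intro F hF hF1
    rw [← (hu 0).lintegral_totalWeight_mul hκ hξ hA0 hF]
    exact tendsto_inv_mul_sum_lintegral (g := fun v => totalWeight κ ε ϱ A v * F v)
      (u := fun k ω m => u k m ω) hum hindep hlaw (hV.mul hF)
      fun v => mul_le_one' (totalWeight_le_one _ _) (hF1 v)
  have hBm : ∀ m : Fin M, MeasurableSet {v : Fin M → ProbabilityMeasure S | v m ∈ B} :=
    fun m => measurable_pi_apply m hB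
  have hone := key (fun _ => 1) measurable_const fun _ => le_rfl
  have hind := ae_all_iff.2 fun m : Fin M => 
    key (fun v => B.indicator (fun _ => (1 : ℝ≥0∞)) (v m))
      ((measurable_const.indicator hB).comp (measurable_pi_apply m))
      fun v => indicator_apply_le' (fun _ => le_rfl) (fun _ => zero_le)
  filter_upwards [hone, hind] with ω h1 h2
  simp only [mul_one, lintegral_one] at h1
  have h3 : ∀ m : Fin M, Tendsto (fun K => weightedEmpirical
      (fun k => totalWeight κ ε ϱ A fun m => u k m ω) (fun k => u k m ω) K B) atTop
      (𝓝 ((ρ univ)⁻¹ * ρ {v | v m ∈ B})) := by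
    intro m
    have hint : ∫⁻ v, B.indicator (fun _ => (1 : ℝ≥0∞)) (v m) ∂ρ = ρ {v | v m ∈ B} :=
      lintegral_indicator_one (hBm m)
    rw [← hint]
    exact tendsto_weightedEmpirical (x := fun k => u k m ω)
      (V := fun k => totalWeight κ ε ϱ A fun m => u k m ω) hB hρ0
      (hint ▸ ne_top_of_le_ne_top hρfin (measure_mono (subset_univ _))) h1 (h2 m)
  have hκ0 : (κ : ℝ≥0∞) + M ≠ 0 := by
    have : (κ : ℝ≥0∞) ≠ 0 := by exact_mod_cast hκ.ne'
    simp [this]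
  have hval : (ProbabilityTheory.cond P
      {ω | ∀ m : Fin M, (fun j : Fin N => ξ m j ω) ∈ A m}).map (μ M) B =
      ((κ : ℝ≥0∞) + M)⁻¹ * (κ * dirichletLaw ((ε : ℝ≥0∞) • (ϱ : Measure S)) B +
        ∑ m, (ρ univ)⁻¹ * ρ {v | v m ∈ B}) := by
    have hμM := hξ.measurable_row M
    rw [Measure.map_apply hμM hB, ProbabilityTheory.cond, Measure.smul_apply,
      Measure.restrict_apply (hμM hB), inter_comm, hξ.measure_next_row_observations hA hB, hRE,
      smul_eq_mul, mul_left_comm, mul_add, ← Finset.mul_sum]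
    congr 2
    rw [mul_comm, mul_assoc, ENNReal.mul_inv_cancel hρ0 hρfin, mul_one]
  simp_rw [newRowApprox_apply]
  rw [hval]
  refine ENNReal.Tendsto.const_mul ?_ (Or.inr (ENNReal.inv_ne_top.2 hκ0))
  exact tendsto_const_nhds.add (tendsto_finsetSum _ fun m _ => h3 m)

end Simulation

end NDP

end

theorem corollary4p2
    {S : Type*} [MetricSpace S] [CompleteSpace S] [TopologicalSpace.SeparableSpace S]
    [MeasurableSpace S] [BorelSpace S]
    {T : Type*} [Countable T]
    {E : Type*} [MetricSpace E] [MeasurableSpace E] [BorelSpace E]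
    {Ω Ω' : Type*} [MeasurableSpace Ω] [MeasurableSpace Ω']
    (P : Measure Ω) [IsProbabilityMeasure P] (P' : Measure Ω') [IsProbabilityMeasure P']
    (κ ε : ℝ≥0) (hκ : 0 < κ) (hε : 0 < ε) (ϱ : ProbabilityMeasure S)
    (ϖ : Ω → ProbabilityMeasure (ProbabilityMeasure S))
    (μ : ℕ → Ω → ProbabilityMeasure S) (ξ : ℕ → ℕ → Ω → S)
    (hξ : NDP.IsNestedDirichletArray P κ ε ϱ ϖ μ ξ)
    (M N : ℕ) (φ : Fin M → (Fin N → S) → T)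
    (hφ : ∀ m t, MeasurableSet (φ m ⁻¹' {t}))
    (Y : Ω → Fin M → T) (hY : Y = fun ω m => φ m fun j => ξ m j ω)
    (y : Fin M → T) (hy : P (Y ⁻¹' {y}) ≠ 0)
    (u : ℕ → Fin M → Ω' → ProbabilityMeasure S)
    (hu : ∀ k, NDP.IsWeightedSimulation P' κ ε ϱ (fun m => φ m ⁻¹' {y m})
      (fun m => hφ m (y m)) (u k))
    (hindep : iIndepFun (fun k ω m => u k m ω) P')
    (V : ℕ → Ω' → ℝ≥0∞)
    (hV : V = fun k ω => NDP.totalWeight κ ε ϱ (fun m => φ m ⁻¹' {y m}) fun m => u k m ω) :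
    (∀ᵐ ω ∂P', NDP.WeaklyConverges
      (NDP.newRowApprox κ (NDP.dirichletLaw ((ε : ℝ≥0∞) • (ϱ : Measure S)))
        (fun k => V k ω) (fun k m => u k m ω))
      ((cond P (Y ⁻¹' {y})).map (μ M))) ∧
    ∀ Φ : ProbabilityMeasure S → E, Measurable Φ →
      (∀ᵐ ω ∂(cond P (Y ⁻¹' {y})), ContinuousAt Φ (μ M ω)) →
      ∀ᵐ ω ∂P', NDP.WeaklyConverges
        (NDP.newRowApprox κ ((NDP.dirichletLaw ((ε : ℝ≥0∞) • (ϱ : Measure S))).map Φ)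
          (fun k => V k ω) (fun k m => Φ (u k m ω)))
        ((cond P (Y ⁻¹' {y})).map fun ω => Φ (μ M ω)) := by
  have := UniformSpace.secondCountable_of_separable S
  have := NDP.secondCountableTopology_probabilityMeasure S
  have := NDP.opensMeasurableSpace_probabilityMeasure S
  have hset : Y ⁻¹' {y} =
      {ω | ∀ m : Fin M, (fun j : Fin N => ξ m j ω) ∈ φ m ⁻¹' {y m}} := by
    ext ω
    simp [hY, funext_iff]
  have h0 := hy
  rw [hset] at h0
  have hA0 := hξ.sampleLaw_ne_zero (fun m => hφ m (y m)) h0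
  have := hξ.isDirichletLaw_row.isProbabilityMeasure
  have := cond_isProbabilityMeasure hy
  have := Measure.isProbabilityMeasure_map (μ := cond P (Y ⁻¹' {y}))
    (hξ.measurable_row M).aemeasurable
  -- The exceptional null set depends on the test set; countability of the family makes a single
  -- null set suffice.
  have hconv := (ae_ball_iff (NDP.countable_basisUnions (X := ProbabilityMeasure S))).2 fun U hU =>
    hξ.ae_tendsto_newRowApprox hκ h0 hu hindep
      (NDP.isOpen_of_mem_basisUnions hU).measurableSet
  have hprob : ∀ ω K, IsProbabilityMeasure
      (NDP.newRowApprox κ (NDP.dirichletLaw ((ε : ℝ≥0∞) • (ϱ : Measure S)))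
        (fun k => V k ω) (fun k m => u k m ω) (K + 1)) := fun ω K =>
    NDP.isProbabilityMeasure_newRowApprox hκ _
      (fun k => hV ▸ NDP.totalWeight_ne_zero hκ hA0 _)
      (fun k => hV ▸ ne_top_of_le_ne_top ENNReal.one_ne_top (NDP.totalWeight_le_one _ _)) _ K
  subst hV
  rw [← hset] at hconv
  constructor
  · filter_upwards [hconv] with ω hω
    -- The first claim is the continuous mapping statement for the identity.
    simpa using NDP.weaklyConverges_map (hprob ω) hω measurable_id
      (ae_of_all _ fun x => continuousAt_id)
  · intro Φ hΦ hc
    filter_upwards [hconv] with ω hω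
    have h := NDP.weaklyConverges_map (hprob ω) hω hΦ <|
      -- The continuity points of a map into a metric space form a Gδ set, so the almost sure
      -- continuity may be transferred to the law of `μ M`.
      (ae_map_iff (hξ.measurable_row M).aemeasurable
        (IsGδ.setOfPred_continuousAt Φ).measurableSet).2 hc
    simp_rw [NDP.newRowApprox_map κ _ _ _ _ hΦ] at h
    rwa [Measure.map_map hΦ (hξ.measurable_row M)] at h
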